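/- **Definitions.** Let $\Psi(\boldsymbol x)=\boldsymbol x/\|\boldsymbol x\|^2$ be the inversion of $\mathbb R^2\setminus\{0\}$ in the unit circle. A nondegenerate frontal in a set $\mathscr C\subset\mathbb R^2$ is a smooth curve $\gamma:I\to\mathscr C$ on an open interval, with $\dot\gamma\neq0$ on a dense subset of $I$, together with a smooth unit vector field $\nu:I\to S^1$ with $\langle\dot\gamma,\nu\rangle=0$. The primitive $\mathcal Pr_{\mathscr C^*}$ is the set of all points $$2\gamma(t)-\frac{\|\gamma(t)\|^2}{\langle\gamma(t),\nu(t)\rangle}\,\nu(t),$$ where $(\gamma,\nu)$ runs over the nondegenerate frontals in $\mathscr C$ and $t$ over the parameters with $\langle\gamma(t),\nu(t)\rangle\ne0$. A front is a smooth curve $\gamma$ with a smooth unit normal $\nu$ such that $(\gamma,\nu)$ is an immersion. An irreducible quadratic curve is a curve with a quadratic equation of nonzero $3\times3$ determinant which is not a union of two (possibly equal) lines. A set has an ordinary cusp (a node) at $p$ if a diffeomorphism between neighbourhoods of $p$ and of the origin takes it to $\{(t^2,t^3)\}$ (to $\{xy=0\}$). **Theorem.** Let $F\in\mathbb R[x,y]$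 be irreducible, and let $\mathscr C$ be the curve $\{F=0\}$, possibly with the origin added as a further point. Let $a,b,r\in\mathbb R$, $r>0$, and suppose that the closure of $\mathcal Pr_{\mathscr C^*}$ is the circle $(x-a)^2+(y-b)^2=r^2$. Put $$Q=(x^2+y^2)^2-2(ax+by)(x^2+y^2)+(a^2-r^2)x^2+(b^2-r^2)y^2+2abxy,$$ $$\lambda(\theta)=\bigl((r+a\cos\theta+b\sin\theta)\cos\theta,\ (r+a\cos\theta+b\sin\theta)\sin\theta\bigr).$$ (1) $\mathscr C=\{Q=0\}$, except that $\mathscr C=\{Q=0\}\setminus\{0\}$ if $a=b=0$ and $0\notin\mathscr C$. For a nonzero constant $c$, $F=cQ$ if $(a,b)\neq(0,0)$, and $(x^2+y^2)F=cQ$ if $a=b=0$. The curve $\mathscr C$ is the limaçon: $\mathscr C=\lambda(\mathbb R)$ if $r^2\le a^2+b^2$, and $\mathscr C\setminus\{0\}=\lambda(\mathbb R)$ if $a^2+b^2<r^2$. Its inversion $\Psi(\mathscr C\setminus\{0\})$ is an irreducible quadratic curve, with the equation $$(r^2-a^2)x^2+(r^2-b^2)y^2-2abxy+2(ax+by)-1=0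 .$$ (2) If $a^2+b^2-r^2=0$, then $\Psi(\mathscr C\setminus\{0\})$ is a parabola and $\mathscr C$ has an ordinary cusp at the origin. (3) If $a^2+b^2-r^2<0$, then $\Psi(\mathscr C\setminus\{0\})$ is an ellipse (possibly a circle); the origin is an isolated point of $\mathscr C$ (provided $0\in\mathscr C$ in the case $a=b=0$); and the other points are non-singular: $\nabla F\ne0$ at every point of $\mathscr C\setminus\{0\}$, and $\lambda'(\theta)\neq0$ for all $\theta$. (4) If $a^2+b^2-r^2>0$, then $\Psi(\mathscr C\setminus\{0\})$ is a hyperbola; $\mathscr C$ has a node at the origin; $\nabla F\ne0$ at every point of $\mathscr C\setminus\{0\}$; and $\mathscr C$ has no singular point as a front: $\lambda$ is a front with $\lambda'(\theta)\neq0$ for all $\theta$. -/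

import Mathlib

open scoped ContDiff

noncomputable section

namespace PlaneCurve

/-- The Euclidean plane. -/
abbrev Plane := EuclideanSpace ℝ (Fin 2)

/-- The real algebraic set `{(x, y) | G(x, y) = 0}`. -/
def zeroSet (G : MvPolynomial (Fin 2) ℝ) : Set Plane :=
  {p | MvPolynomial.eval (fun i => p i) G = 0}

/-- `(γ, ν)` is a Legendrian curve on the (open) parameter set `I`: smooth, with `ν` a unit vector
field normal to `γ`. -/
def IsLegendrianOn (γ ν : ℝ → Plane) (I : Set ℝ) : Prop :=
  ContDiffOn ℝ ∞ γ I ∧ ContDiffOn ℝ ∞ ν I ∧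
    ∀ t ∈ I, ‖ν t‖ = 1 ∧ inner ℝ (deriv γ t) (ν t) = 0

/-- `γ` is a front on the (open) parameter set `I`: it lifts to an immersed Legendrian curve. -/
def IsFrontOn (γ : ℝ → Plane) (I : Set ℝ) : Prop :=
  ∃ ν : ℝ → Plane, IsLegendrianOn γ ν I ∧ ∀ t ∈ I, deriv γ t ≠ 0 ∨ deriv ν t ≠ 0

/-- The point at parameter `t` of the primitive of the frontal `γ` with unit normal `ν`. -/
def primitivePoint (γ ν : ℝ → Plane) (t : ℝ) : Plane :=
  (2 : ℝ) • γ t - (‖γ t‖ ^ 2 / inner ℝ (γ t) (ν t)) • ν t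

/-- The primitive of (the part satisfying `⟨γ, ν⟩ ≠ 0` of) a plane set `S`: all primitive points of
frontals running in `S`, at the parameters where `⟨γ, ν⟩ ≠ 0`. The frontals are nondegenerate
(their regular parameters are dense), so that `ν` is determined up to sign by the tangent lines of
the curve; a frontal resting at one point while its normal turns is not a parametrization of
the curve. -/
def primitive (S : Set Plane) : Set Plane :=
  {q | ∃ (γ ν : ℝ → Plane) (s₁ s₂ t : ℝ), IsLegendrianOn γ ν (Set.Ioo s₁ s₂) ∧
    Set.Ioo s₁ s₂ ⊆ closure {s ∈ Set.Ioo s₁ s₂ | deriv γ s ≠ 0} ∧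
    (∀ s ∈ Set.Ioo s₁ s₂, γ s ∈ S) ∧
    t ∈ Set.Ioo s₁ s₂ ∧ inner ℝ (γ t) (ν t) ≠ 0 ∧ q = primitivePoint γ ν t}

/-- The image of `S`, without the origin, under the inversion in the unit circle. -/
def inversionImage (S : Set Plane) : Set Plane :=
  EuclideanGeometry.inversion (0 : Plane) 1 '' (S \ {0})

/-- The circle `(x - a)² + (y - b)² = r²`. -/
def circle (a b r : ℝ) : Set Plane := {p | (p 0 - a) ^ 2 + (p 1 - b) ^ 2 = r ^ 2}

/-- The parametrization of the (generalized) limaçon, the pedal of the circle with center `(a, b)`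
and radius `r`. -/
def limacon (a b r θ : ℝ) : Plane :=
  !₂[(r + a * Real.cos θ + b * Real.sin θ) * Real.cos θ,
     (r + a * Real.cos θ + b * Real.sin θ) * Real.sin θ]

open MvPolynomial in
/-- The polynomial
`(x² + y²)² - 2(ax + by)(x² + y²) + (a² - r²)x² + (b² - r²)y² + 2abxy`. -/
def limaconPoly (a b r : ℝ) : MvPolynomial (Fin 2) ℝ :=
  (X 0 ^ 2 + X 1 ^ 2) ^ 2 - 2 * (C a * X 0 + C b * X 1) * (X 0 ^ 2 + X 1 ^ 2)
    + C (a ^ 2 - r ^ 2) * X 0 ^ 2 + C (b ^ 2 - r ^ 2) * X 1 ^ 2 + C (2 * a * b) * X 0 * X 1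

/-- The set `(r² - a²)x² + (r² - b²)y² - 2abxy + 2(ax + by) - 1 = 0`. -/
def invConic (a b r : ℝ) : Set Plane :=
  {p | (r ^ 2 - a ^ 2) * p 0 ^ 2 + (r ^ 2 - b ^ 2) * p 1 ^ 2 - 2 * a * b * p 0 * p 1
    + 2 * (a * p 0 + b * p 1) - 1 = 0}

/-- Straight lines. -/
def IsLine (L : Set Plane) : Prop :=
  ∃ q w : Plane, w ≠ 0 ∧ L = Set.range (fun t : ℝ => q + t • w)

/-- `S` is given by a quadratic equation with non-vanishing determinant `Δ`, and is not the union of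
two (possibly equal) lines. -/
def IsIrreducibleQuadraticCurve (S : Set Plane) : Prop :=
  (∃ a₁₁ a₂₂ a₁₂ a₁ a₂ c : ℝ, (a₁₁ ≠ 0 ∨ a₂₂ ≠ 0 ∨ a₁₂ ≠ 0) ∧
    Matrix.det !![a₁₁, a₁₂, a₁; a₁₂, a₂₂, a₂; a₁, a₂, c] ≠ 0 ∧
    S = {p | a₁₁ * p 0 ^ 2 + a₂₂ * p 1 ^ 2 + 2 * a₁₂ * p 0 * p 1 + 2 * a₁ * p 0 + 2 * a₂ * p 1
      + c = 0}) ∧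
  ¬ ∃ L₁ L₂ : Set Plane, IsLine L₁ ∧ IsLine L₂ ∧ S = L₁ ∪ L₂

/-- Ellipses (circles included): `(x/α)² + (y/β)² = 1` in the coordinates of some orthonormal frame
`u, v` at some point `o`. -/
def IsEllipse (S : Set Plane) : Prop :=
  ∃ (o u v : Plane) (α β : ℝ), Orthonormal ℝ ![u, v] ∧ 0 < α ∧ 0 < β ∧
    S = {p | (inner ℝ u (p - o) / α) ^ 2 + (inner ℝ v (p - o) / β) ^ 2 = 1}

/-- Hyperbolas: `(x/α)² - (y/β)² = 1` in some orthonormal frame. -/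
def IsHyperbola (S : Set Plane) : Prop :=
  ∃ (o u v : Plane) (α β : ℝ), Orthonormal ℝ ![u, v] ∧ 0 < α ∧ 0 < β ∧
    S = {p | (inner ℝ u (p - o) / α) ^ 2 - (inner ℝ v (p - o) / β) ^ 2 = 1}

/-- Parabolas: `y = α x²` in some orthonormal frame. -/
def IsParabola (S : Set Plane) : Prop :=
  ∃ (o u v : Plane) (α : ℝ), Orthonormal ℝ ![u, v] ∧ α ≠ 0 ∧
    S = {p | inner ℝ v (p - o) = α * (inner ℝ u (p - o)) ^ 2}

/-- `S` near `p` is mapped onto `T` near `q` by a diffeomorphism between open neighbourhoods of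
`p` and `q`. -/
def LocallyDiffeomorphicAt (S : Set Plane) (p : Plane) (T : Set Plane) (q : Plane) : Prop :=
  ∃ Φ : OpenPartialHomeomorph Plane Plane, p ∈ Φ.source ∧ Φ p = q ∧
    ContDiffOn ℝ ∞ Φ Φ.source ∧ ContDiffOn ℝ ∞ Φ.symm Φ.target ∧
    Φ '' (S ∩ Φ.source) = T ∩ Φ.target

/-- `S` has an ordinary cusp at `p`: it looks locally like `{(t², t³)}` at the origin. -/
def HasOrdinaryCuspAt (S : Set Plane) (p : Plane) : Prop :=
  LocallyDiffeomorphicAt S p (Set.range (fun t : ℝ => (!₂[t ^ 2, t ^ 3] : Plane))) 0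

/-- `S` has a node at `p`: it looks locally like two transversal lines, `xy = 0`, at the origin. -/
def HasNodeAt (S : Set Plane) (p : Plane) : Prop :=
  LocallyDiffeomorphicAt S p {z | z 0 * z 1 = 0} 0

/-- `p` is an isolated point of `S`. -/
def IsIsolatedPointOf (S : Set Plane) (p : Plane) : Prop :=
  ∃ U : Set Plane, IsOpen U ∧ S ∩ U = {p}

/-- The gradient of `G` does not vanish at `p`. -/
def IsNonsingularAt (G : MvPolynomial (Fin 2) ℝ) (p : Plane) : Prop :=
  ∃ i : Fin 2, MvPolynomial.eval (fun j => p j) (MvPolynomial.pderiv i G) ≠ 0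

end PlaneCurve

end

/-! Write `c = (a, b)` and let `q` be the point of the primitive belonging to the point `p = γ t`.
Then `⟪q, p⟫ = ‖p‖²`, and the primitive is the envelope of the lines through `γ t` orthogonal to
`γ t`, so its velocity at `q` is orthogonal to `p`. Where this velocity is nonzero it is orthogonal
to `q - c` as well, since `q` moves on the circle; hence `q - c` is parallel to `p`, that is
`⟪q - c, p⟫² = r² ‖p‖²`, which is the equation `(‖p‖² - ⟪c, p⟫)² = r² ‖p‖²` of the limaçon. If
instead the velocity vanishes identically, then `q` is constant and `p` runs on the circle with
diameter from `0` to `q`. A frontal has infinite image, so the irreducible `F` divides `Q` or the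
equation of that circle; the latter cannot hold for two different points `q` of the primitive.
Finally `Q` is irreducible for `c ≠ 0`: its quotient by `x²` under the blow-up `y = m x` is a
quadratic polynomial in `x` whose discriminant is `1 + m²` up to squares.

Inversion turns the limaçon into `r² ‖p‖² = (1 - ⟪c, p⟫)²`, the conic with focus `0`, directrix
`⟪c, p⟫ = 1` and eccentricity `‖c‖ / r`. -/

noncomputable section

namespace PlaneCurve

section Algebra

open Polynomial Polynomial.Bivariate nonZeroDivisors

theorem exists_mul_add_mul_eq_C {R : Type*} [CommRing R] [IsDomain R] [IsGCDMonoid R] {f g : R[X]}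
    (hf : Irreducible f) (hfg : ¬ f ∣ g) :
    ∃ (d : R) (u v : R[X]), d ≠ 0 ∧ u * f + v * g = C d := by
  by_cases hdeg : f.natDegree = 0
  · obtain ⟨d, rfl⟩ := natDegree_eq_zero.mp hdeg
    exact ⟨d, 1, 0, fun hd => hf.ne_zero (by rw [hd, C_0]), by ring⟩
  · let K := FractionRing R
    have hp := hf.isPrimitive hdeg
    have hK : Irreducible (f.map (algebraMap R K)) :=
      hp.irreducible_iff_irreducible_map_fraction_map.mp hf
    have hnd : ¬ f.map (algebraMap R K) ∣ g.map (algebraMap R K) :=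
      fun h => hfg (hp.dvd_of_fraction_map_dvd_fraction_map h)
    obtain ⟨u, v, huv⟩ := hK.coprime_iff_not_dvd.mpr hnd
    obtain ⟨b, hb, hu⟩ := IsLocalization.integerNormalization_spec R⁰ u
    obtain ⟨c, hc, hv⟩ := IsLocalization.integerNormalization_spec R⁰ v
    refine ⟨b * c, C c * IsLocalization.integerNormalization R⁰ u,
      C b * IsLocalization.integerNormalization R⁰ v,
      mul_ne_zero (nonZeroDivisors.ne_zero hb) (nonZeroDivisors.ne_zero hc), ?_⟩
    apply map_injective _ (IsFractionRing.injective R K)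
    rw [Algebra.smul_def, Polynomial.algebraMap_apply] at hu hv
    simp only [Polynomial.map_add, Polynomial.map_mul, Polynomial.map_C, hu, hv, map_mul]
    linear_combination (C (algebraMap R K b) * C (algebraMap R K c)) * huv

theorem evalEval_equivMvPolynomial_symm {R : Type*} [CommRing R] (v : Fin 2 → R)
    (G : MvPolynomial (Fin 2) R) :
    ((equivMvPolynomial R).symm G).evalEval (v 0) (v 1) = MvPolynomial.eval v G := by
  have h : (evalEvalRingHom (v 0) (v 1)).comp ((equivMvPolynomial R).symm : _ →+* R[X][Y])
      = MvPolynomial.eval v := by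
    ext i
    · simp
    · fin_cases i <;> simp
  exact congrArg (fun φ => φ G) h

section Field

variable {K : Type*} [Field K] {F G : MvPolynomial (Fin 2) K}

theorem finite_fst_image_common_zeros (hF : Irreducible F) (hFG : ¬ F ∣ G) :
    ((fun v : Fin 2 → K => v 0) ''
      {v | MvPolynomial.eval v F = 0 ∧ MvPolynomial.eval v G = 0}).Finite := by
  obtain ⟨d, u, w, hd, h⟩ := exists_mul_add_mul_eq_C
    ((MulEquiv.irreducible_iff (equivMvPolynomial K).symm).mpr hF)
    (fun h => hFG ((map_dvd_iff (equivMvPolynomial K).symm).mp h))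
  refine (finite_setOfPred_isRoot hd).subset ?_
  rintro _ ⟨v, ⟨hvF, hvG⟩, rfl⟩
  have hv := congrArg (evalEval (v 0) (v 1)) h
  rwa [evalEval_add, evalEval_mul, evalEval_mul, evalEval_equivMvPolynomial_symm,
    evalEval_equivMvPolynomial_symm, hvF, hvG, mul_zero, mul_zero, add_zero, evalEval_C,
    eq_comm] at hv

theorem finite_common_zeros (hF : Irreducible F) (hFG : ¬ F ∣ G) :
    {v : Fin 2 → K | MvPolynomial.eval v F = 0 ∧ MvPolynomial.eval v G = 0}.Finite := by
  set Z := {v : Fin 2 → K | MvPolynomial.eval v F = 0 ∧ MvPolynomial.eval v G = 0}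
  let e := MvPolynomial.renameEquiv K (Equiv.swap (0 : Fin 2) 1)
  have hswap (v : Fin 2 → K) (H : MvPolynomial (Fin 2) K) :
      MvPolynomial.eval (v ∘ Equiv.swap 0 1) (e H) = MvPolynomial.eval v H := by
    have hv : (v ∘ Equiv.swap (0 : Fin 2) 1) ∘ Equiv.swap 0 1 = v := by ext i; simp
    rw [MvPolynomial.renameEquiv_apply, MvPolynomial.eval_rename, hv]
  have hsnd : ((fun v : Fin 2 → K => v 1) '' Z).Finite := by
    refine (finite_fst_image_common_zeros ((MulEquiv.irreducible_iff e).mpr hF)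
      (fun h => hFG ((map_dvd_iff e).mp h))).subset ?_
    rintro _ ⟨v, ⟨hvF, hvG⟩, rfl⟩
    exact ⟨_, ⟨(hswap v F).trans hvF, (hswap v G).trans hvG⟩, by simp⟩
  have hcoord : ∀ i, ((fun v : Fin 2 → K => v i) '' Z).Finite :=
    Fin.forall_fin_two.mpr ⟨finite_fst_image_common_zeros hF hFG, hsnd⟩
  exact (Set.Finite.pi' hcoord).subset fun v hv i => ⟨v, hv, rfl⟩

end Field

theorem prime_quadratic {R : Type*} [CommRing R] [IsDomain R] [IsGCDMonoid R] {A B D e Δ : R}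
    (hA : A ≠ 0) (hAD : IsRelPrime A D) (he : e ≠ 0) (hdisc : discrim A B D = e ^ 2 * Δ)
    (hΔ : ¬ IsSquare Δ) : Prime (C A * X ^ 2 + C B * X + C D) := by
  have hp : (C A * X ^ 2 + C B * X + C D).IsPrimitive := by
    intro c hc
    rw [C_dvd_iff_dvd_coeff] at hc
    exact hAD (by simpa using hc 2) (by simpa using hc 0)
  let K := FractionRing R
  have hinj : Function.Injective (algebraMap R K) := IsFractionRing.injective _ _
  have hA' : algebraMap R K A ≠ 0 := (map_ne_zero_iff _ hinj).mpr hA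
  have he' : algebraMap R K e ≠ 0 := (map_ne_zero_iff _ hinj).mpr he
  refine Irreducible.prime (hp.irreducible_iff_irreducible_map_fraction_map (K := K) |>.mpr ?_)
  simp only [Polynomial.map_add, Polynomial.map_mul, Polynomial.map_C, Polynomial.map_pow,
    Polynomial.map_X]
  refine irreducible_of_degree_le_three_of_not_isRoot (by simp [natDegree_quadratic hA'])
    fun x hx => hΔ ?_
  have hroot : algebraMap R K A * (x * x) + algebraMap R K B * x + algebraMap R K D = 0 := by
    simpa [IsRoot, pow_two] using hx
  have hsq : ((2 * algebraMap R K A * x + algebraMap R K B) / algebraMap R K e) ^ 2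
      = algebraMap R K Δ := by
    rw [div_pow, ← discrim_eq_sq_of_quadratic_eq_zero hroot, div_eq_iff (pow_ne_zero 2 he'),
      ← map_pow, ← map_mul, mul_comm, ← hdisc]
    simp only [discrim, map_sub, map_mul, map_pow, map_ofNat]
  obtain ⟨g, hg⟩ := IsIntegrallyClosed.exists_algebraMap_eq_of_isIntegral_pow
    (R := R) (n := 2) two_pos (hsq ▸ isIntegral_algebraMap)
  exact ⟨g, hinj (by rw [← hsq, ← hg, map_mul, pow_two])⟩

theorem not_isSquare_one_add_X_sq {K : Type*} [Field K] [LinearOrder K] [IsStrictOrderedRing K] :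
    ¬ IsSquare (1 + X ^ 2 : K[X]) := by
  rintro ⟨g, hg⟩
  have hdeg : g.natDegree = 1 := by
    have h := congrArg natDegree hg
    rw [← pow_two, natDegree_pow, add_comm, ← C_1, natDegree_X_pow_add_C] at h
    lia
  obtain ⟨z, hz⟩ :=
    exists_root_of_degree_eq_one ((degree_eq_iff_natDegree_eq_of_pos one_pos).mpr hdeg)
  have h := congrArg (eval z) hg
  rw [eval_mul, hz.eq_zero, mul_zero, eval_add, eval_one, eval_pow, eval_X] at h
  linarith [sq_nonneg z]

/-- The total transform of a polynomial under the blow-up `x = s`, `y = m s` of the plane at the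
origin, as a polynomial in `s` over `R[m]`. -/
def blowUp (R : Type*) [CommRing R] : MvPolynomial (Fin 2) R →ₐ[R] R[X][X] :=
  MvPolynomial.aeval ![X, C X * X]

theorem blowUp_C {R : Type*} [CommRing R] (c : R) : blowUp R (MvPolynomial.C c) = C (C c) :=
  MvPolynomial.aeval_C _ c

theorem blowUp_X_zero {R : Type*} [CommRing R] : blowUp R (MvPolynomial.X 0) = X :=
  MvPolynomial.aeval_X _ 0

theorem blowUp_X_one {R : Type*} [CommRing R] : blowUp R (MvPolynomial.X 1) = C X * X :=
  MvPolynomial.aeval_X _ 1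

theorem evalEval_blowUp {R : Type*} [CommRing R] (m s : R) (G : MvPolynomial (Fin 2) R) :
    (blowUp R G).evalEval m s = MvPolynomial.eval ![s, m * s] G := by
  have h : (evalEvalRingHom m s).comp (blowUp R : _ →+* R[X][X])
      = MvPolynomial.eval ![s, m * s] := by
    ext i
    · simp
    · fin_cases i <;> simp [blowUp_X_zero, blowUp_X_one, -X_mul_C]
  exact congrArg (fun φ => φ G) h

section BlowUp

variable {K : Type*} [Field K] [Infinite K]

theorem blowUp_injective : Function.Injective (blowUp K) := by
  refine (injective_iff_map_eq_zero _).mpr fun G hG => ?_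
  refine (mul_eq_zero.mp (MvPolynomial.funext (q := 0) fun v => ?_)).resolve_left
    (MvPolynomial.X_ne_zero (0 : Fin 2))
  rw [map_mul, map_zero, MvPolynomial.eval_X, mul_eq_zero, or_iff_not_imp_left]
  intro hv
  have h := evalEval_blowUp (v 1 / v 0) (v 0) G
  rw [hG, evalEval_zero, div_mul_cancel₀ _ hv] at h
  rw [h]
  exact congrArg (MvPolynomial.eval · G) (List.ofFn_inj.mp rfl)

theorem isUnit_of_blowUp_dvd {G : MvPolynomial (Fin 2) K} {j : ℕ} (h : blowUp K G ∣ X ^ j) {y : K}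
    (hy : MvPolynomial.eval ![0, y] G ≠ 0) : IsUnit G := by
  obtain ⟨k, -, u, hu⟩ := (dvd_prime_pow prime_X j).mp h
  obtain ⟨p, hp, hpu⟩ := isUnit_iff.mp u.isUnit
  obtain ⟨c, hc, rfl⟩ := isUnit_iff.mp hp
  have hG : G * MvPolynomial.C c = MvPolynomial.X 0 ^ k := by
    apply blowUp_injective
    rw [map_mul, map_pow, blowUp_C, blowUp_X_zero, hpu, hu]
  have hk : k = 0 := by
    by_contra hk
    have h := congrArg (MvPolynomial.eval ![0, y]) hG
    rw [map_mul, map_pow, MvPolynomial.eval_C, MvPolynomial.eval_X, Matrix.cons_val_zero,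
      zero_pow hk] at h
    exact hc.ne_zero ((mul_eq_zero.mp h).resolve_left hy)
  exact IsUnit.of_mul_eq_one _ (by rw [hG, hk, pow_zero])

theorem irreducible_of_blowUp {G : MvPolynomial (Fin 2) K} {j : ℕ} {S : K[X][X]} (hS : Prime S)
    (hG : blowUp K G = X ^ j * S) {y : K} (hy : MvPolynomial.eval ![0, y] G ≠ 0) :
    Irreducible G where
  not_isUnit h := hS.not_isUnit (isUnit_of_mul_isUnit_right (hG ▸ h.map (blowUp K)))
  isUnit_or_isUnit {F H} h := by
    have isUnit_of_dvd {F H} (h : G = F * H) (hF : S ∣ blowUp K F) : IsUnit H := by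
      obtain ⟨L, hL⟩ := hF
      rw [h, map_mul, hL] at hG
      refine isUnit_of_blowUp_dvd (j := j) (y := y) ⟨L, mul_left_cancel₀ hS.ne_zero ?_⟩
        (right_ne_zero_of_mul (a := MvPolynomial.eval ![0, y] F) ?_)
      · linear_combination -hG
      · rwa [← map_mul, ← h]
    have hdvd : S ∣ blowUp K F * blowUp K H := ⟨X ^ j, by rw [← map_mul, ← h, hG, mul_comm]⟩
    exact (hS.dvd_or_dvd hdvd).symm.imp (isUnit_of_dvd (h.trans (mul_comm _ _)))
      (isUnit_of_dvd h)

end BlowUp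

end Algebra

section Equations

open MvPolynomial
open scoped RealInnerProductSpace

/-- The center `(a, b)` of `circle a b r`, as a vector. -/
def center (a b : ℝ) : Plane := !₂[a, b]

theorem inner_plane (p q : Plane) : ⟪p, q⟫ = p 0 * q 0 + p 1 * q 1 := by
  simp [PiLp.inner_apply, Fin.sum_univ_two, mul_comm]

theorem norm_sq_plane (p : Plane) : ‖p‖ ^ 2 = p 0 ^ 2 + p 1 ^ 2 := by
  rw [← real_inner_self_eq_norm_sq, inner_plane, pow_two, pow_two]

theorem inner_center (a b : ℝ) (p : Plane) : ⟪center a b, p⟫ = a * p 0 + b * p 1 :=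
  inner_plane _ p

theorem norm_center_sq (a b : ℝ) : ‖center a b‖ ^ 2 = a ^ 2 + b ^ 2 :=
  norm_sq_plane _

theorem mem_circle {a b r : ℝ} {p : Plane} : p ∈ circle a b r ↔ ‖p - center a b‖ ^ 2 = r ^ 2 := by
  rw [norm_sq_plane]; rfl

theorem mem_zeroSet {G : MvPolynomial (Fin 2) ℝ} {p : Plane} :
    p ∈ zeroSet G ↔ eval (fun i => p i) G = 0 :=
  Iff.rfl

theorem mem_zeroSet_limaconPoly {a b r : ℝ} {p : Plane} :
    p ∈ zeroSet (limaconPoly a b r) ↔ (‖p‖ ^ 2 - ⟪center a b, p⟫) ^ 2 = r ^ 2 * ‖p‖ ^ 2 := by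
  rw [mem_zeroSet, ← sub_eq_zero (a := (_ - _) ^ 2), norm_sq_plane, inner_center]
  refine Eq.congr_left ?_
  simp only [limaconPoly, map_add, map_sub, map_mul, map_pow, map_ofNat, eval_C, eval_X]
  ring

theorem zero_mem_zeroSet_limaconPoly (a b r : ℝ) : 0 ∈ zeroSet (limaconPoly a b r) := by
  simp [mem_zeroSet_limaconPoly]

/-- The equation `x² + y² = r²`. -/
def circlePoly (r : ℝ) : MvPolynomial (Fin 2) ℝ := X 0 ^ 2 + X 1 ^ 2 - C (r ^ 2)

theorem limaconPoly_zero_zero (r : ℝ) :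
    limaconPoly 0 0 r = (X 0 ^ 2 + X 1 ^ 2) * circlePoly r := by
  simp only [limaconPoly, circlePoly, map_sub, map_mul, map_pow, map_zero]
  ring

/-- The equation `‖p‖² = ⟪q, p⟫` of the circle with diameter from the origin to `q`. -/
def diameterPoly (q : Plane) : MvPolynomial (Fin 2) ℝ :=
  X 0 ^ 2 + X 1 ^ 2 - (C (q 0) * X 0 + C (q 1) * X 1)

theorem mem_zeroSet_diameterPoly {p q : Plane} :
    p ∈ zeroSet (diameterPoly q) ↔ ‖p‖ ^ 2 = ⟪q, p⟫ := by
  rw [mem_zeroSet, ← sub_eq_zero (a := ‖p‖ ^ 2), norm_sq_plane, inner_plane]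
  simp [diameterPoly]

end Equations

section Irreducibility

open Polynomial

variable {a b r : ℝ}

theorem one_add_X_sq_ne_zero : (1 + X ^ 2 : ℝ[X]) ≠ 0 := fun h =>
  not_isSquare_one_add_X_sq (K := ℝ) (h ▸ IsSquare.zero)

theorem isCoprime_one_add_X_sq_linear (hab : a ≠ 0 ∨ b ≠ 0) :
    IsCoprime (1 + X ^ 2 : ℝ[X]) (C a + C b * X) := by
  have hpos : a ^ 2 + b ^ 2 ≠ 0 := fun h =>
    hab.elim (fun ha => ha (by nlinarith)) (fun hb => hb (by nlinarith))
  refine IsCoprime.symm ⟨C (a ^ 2 + b ^ 2)⁻¹ * (C a - C b * X), C (a ^ 2 + b ^ 2)⁻¹ * C b ^ 2, ?_⟩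
  have hinv : C (a ^ 2 + b ^ 2)⁻¹ * (C a ^ 2 + C b ^ 2) = 1 := by
    rw [← C_pow, ← C_pow, ← C_add, ← C_mul, inv_mul_cancel₀ hpos, C_1]
  linear_combination hinv

theorem irreducible_limaconPoly (hr : r ≠ 0) (hab : a ≠ 0 ∨ b ≠ 0) :
    Irreducible (limaconPoly a b r) := by
  have hprime := prime_quadratic (A := (1 + X ^ 2) ^ 2) (B := -2 * (1 + X ^ 2) * (C a + C b * X))
    (D := (C a + C b * X) ^ 2 + (1 + X ^ 2) * -C (r ^ 2)) (e := 2 * C r * (1 + X ^ 2))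
    (pow_ne_zero 2 one_add_X_sq_ne_zero)
    (((isCoprime_one_add_X_sq_linear hab).pow_right.add_mul_left_right _).pow_left.isRelPrime)
    (mul_ne_zero (mul_ne_zero two_ne_zero (C_ne_zero.mpr hr)) one_add_X_sq_ne_zero)
    (by rw [discrim, C_pow]; ring) not_isSquare_one_add_X_sq
  refine irreducible_of_blowUp (j := 2) (y := |b| + 2 * |r|) hprime ?_ ?_
  · simp only [limaconPoly, map_add, map_sub, map_mul, map_pow, map_neg, map_one, map_ofNat,
      blowUp_C, blowUp_X_zero, blowUp_X_one]
    ring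
  · have hy : 0 < |b| + 2 * |r| := by positivity
    have heval : MvPolynomial.eval ![0, |b| + 2 * |r|] (limaconPoly a b r)
        = (|b| + 2 * |r|) ^ 2 * ((|b| + 2 * |r| - b) ^ 2 - r ^ 2) := by
      simp [limaconPoly]
      ring
    have hlt : r ^ 2 < (|b| + 2 * |r| - b) ^ 2 := by
      rw [sq_lt_sq]
      have := abs_pos.mpr hr
      linarith [le_abs_self b, le_abs_self (|b| + 2 * |r| - b)]
    rw [heval]
    exact mul_ne_zero (pow_ne_zero 2 hy.ne') (sub_pos.mpr hlt).ne'

theorem irreducible_circlePoly (hr : r ≠ 0) : Irreducible (circlePoly r) := by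
  have hprime := prime_quadratic (A := 1 + X ^ 2) (B := 0) (D := C (-r ^ 2)) (e := 2 * C r)
    one_add_X_sq_ne_zero
    (isUnit_C.mpr (neg_ne_zero.mpr (pow_ne_zero 2 hr)).isUnit).isRelPrime_right
    (mul_ne_zero two_ne_zero (C_ne_zero.mpr hr))
    (by rw [discrim, C_neg, C_pow]; ring) not_isSquare_one_add_X_sq
  refine irreducible_of_blowUp (j := 0) (y := 0) hprime ?_ ?_
  · simp only [circlePoly, map_add, map_sub, map_pow, map_neg, map_one, map_zero,
      blowUp_C, blowUp_X_zero, blowUp_X_one]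
    ring
  · simp [circlePoly, hr]

end Irreducibility

section Factors

open MvPolynomial

variable {F : MvPolynomial (Fin 2) ℝ} {a b r : ℝ}

theorem exists_eq_C_mul_of_dvd {σ K : Type*} [Field K] {F G : MvPolynomial σ K}
    (hF : Irreducible F) (hG : Irreducible G) (h : F ∣ G) : ∃ c : K, c ≠ 0 ∧ F = C c * G := by
  obtain ⟨u, hu⟩ := (hF.associated_of_dvd hG h).symm
  obtain ⟨c, hc, huc⟩ := isUnit_iff_eq_C_of_isReduced.mp u.isUnit
  exact ⟨c, hc.ne_zero, by rw [← hu, huc, mul_comm]⟩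

theorem exists_mul_eq_C_mul_limaconPoly_zero_zero (hF : Irreducible F) (hr : r ≠ 0)
    (hdvd : F ∣ limaconPoly 0 0 r) (hne : (zeroSet F \ {0}).Nonempty) :
    ∃ c : ℝ, c ≠ 0 ∧ (X 0 ^ 2 + X 1 ^ 2) * F = C c * limaconPoly 0 0 r := by
  obtain ⟨p, hp, hp0⟩ := hne
  rw [limaconPoly_zero_zero] at hdvd ⊢
  have hndvd : ¬ F ∣ X 0 ^ 2 + X 1 ^ 2 := by
    rintro ⟨H, hH⟩
    have h := congrArg (eval fun i => p i) hH
    rw [map_mul, mem_zeroSet.mp hp, zero_mul] at h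
    exact pow_ne_zero 2 (norm_ne_zero_iff.mpr hp0) (by simpa [norm_sq_plane] using h)
  obtain ⟨c, hc, h⟩ := exists_eq_C_mul_of_dvd hF (irreducible_circlePoly hr)
    ((hF.prime.dvd_or_dvd hdvd).resolve_left hndvd)
  exact ⟨c, hc, by rw [h]; ring⟩

theorem exists_mul_eq_C_mul_limaconPoly (hF : Irreducible F) (hr : r ≠ 0)
    (hdvd : F ∣ limaconPoly a b r) (hne : (zeroSet F \ {0}).Nonempty) :
    ∃ (G : MvPolynomial (Fin 2) ℝ) (c : ℝ), c ≠ 0 ∧ zeroSet G ⊆ {0} ∧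
      G * F = C c * limaconPoly a b r := by
  by_cases hab : a ≠ 0 ∨ b ≠ 0
  · obtain ⟨c, hc, h⟩ := exists_eq_C_mul_of_dvd hF (irreducible_limaconPoly hr hab) hdvd
    exact ⟨1, c, hc, by simp [zeroSet], by rw [one_mul, h]⟩
  · obtain ⟨rfl, rfl⟩ : a = 0 ∧ b = 0 := by push Not at hab; exact hab
    obtain ⟨c, hc, h⟩ := exists_mul_eq_C_mul_limaconPoly_zero_zero hF hr hdvd hne
    refine ⟨_, c, hc, fun q hq => ?_, h⟩
    simpa [zeroSet, ← norm_sq_plane] using hq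

theorem zeroSet_sdiff_zero_eq_of_mul_eq {G Q : MvPolynomial (Fin 2) ℝ} {c : ℝ} (hc : c ≠ 0)
    (hG : zeroSet G ⊆ {0}) (h : G * F = C c * Q) : zeroSet F \ {0} = zeroSet Q \ {0} := by
  ext p
  refine and_congr_left fun hp => ?_
  have hGp : eval (fun i => p i) G ≠ 0 := fun h => hp (hG h)
  have heval := congrArg (eval fun i => p i) h
  rw [map_mul, map_mul, eval_C] at heval
  rw [mem_zeroSet, mem_zeroSet, ← mul_eq_zero_iff_left hGp, heval, mul_eq_zero_iff_left hc]

theorem dvd_of_infinite {G : MvPolynomial (Fin 2) ℝ} (hF : Irreducible F) {S : Set Plane}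
    (hS : S.Infinite) (hSF : S ⊆ zeroSet F) (hSG : S ⊆ zeroSet G) : F ∣ G := by
  by_contra h
  exact hS (((finite_common_zeros hF h).preimage (WithLp.ofLp_injective 2).injOn).subset
    fun p hp => ⟨hSF hp, hSG hp⟩)

end Factors

section Orthogonality

open Module
open scoped RealInnerProductSpace

variable {E : Type*} [NormedAddCommGroup E] [InnerProductSpace ℝ E] [Fact (finrank ℝ E = 2)]

theorem inner_sq_eq_of_inner_eq_zero {w x y : E} (hw : w ≠ 0) (hx : ⟪w, x⟫ = 0) (hy : ⟪w, y⟫ = 0) :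
    ⟪x, y⟫ ^ 2 = ‖x‖ ^ 2 * ‖y‖ ^ 2 := by
  rcases eq_or_ne y 0 with rfl | hy0
  · simp
  · obtain ⟨k, rfl⟩ := Submodule.mem_span_singleton.mp
      (Submodule.mem_span_singleton_of_inner_eq_zero_of_inner_eq_zero hw hy0 hx hy)
    rw [real_inner_smul_left, real_inner_self_eq_norm_sq, norm_smul, mul_pow, mul_pow,
      Real.norm_eq_abs, sq_abs]
    ring

theorem eq_of_norm_sq_eq_inner {q q' x y : E} (hq : q ≠ q') (hx : x ≠ 0) (hy : y ≠ 0)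
    (hxq : ‖x‖ ^ 2 = ⟪q, x⟫) (hxq' : ‖x‖ ^ 2 = ⟪q', x⟫) (hyq : ‖y‖ ^ 2 = ⟪q, y⟫)
    (hyq' : ‖y‖ ^ 2 = ⟪q', y⟫) : x = y := by
  have hqx : ⟪q - q', x⟫ = 0 := by rw [inner_sub_left, ← hxq, ← hxq', sub_self]
  have hqy : ⟪q - q', y⟫ = 0 := by rw [inner_sub_left, ← hyq, ← hyq', sub_self]
  obtain ⟨k, rfl⟩ := Submodule.mem_span_singleton.mp
    (Submodule.mem_span_singleton_of_inner_eq_zero_of_inner_eq_zero (sub_ne_zero.mpr hq) hy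
      hqx hqy)
  have hk : k * (k - 1) * ‖y‖ ^ 2 = 0 := by
    rw [norm_smul, real_inner_smul_right, ← hyq, mul_pow, Real.norm_eq_abs, sq_abs] at hxq
    linear_combination hxq
  have hk0 : k ≠ 0 := fun h => hx (by rw [h, zero_smul])
  have hk1 : k = 1 := by simpa [hk0, hy, sub_eq_zero] using hk
  rw [hk1, one_smul]

end Orthogonality

section Frontal

open Set Filter Topology
open scoped RealInnerProductSpace EuclideanSpace

theorem infinite_image_of_hasDerivAt {E : Type*} [NormedAddCommGroup E] [NormedSpace ℝ E]
    {f : ℝ → E} {f' : E} {s : ℝ} (hf : HasDerivAt f f' s) (hf' : f' ≠ 0) {U : Set ℝ}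
    (hU : U ∈ 𝓝 s) : (f '' U).Infinite := by
  intro hfin
  have hother : ∀ᶠ z in 𝓝 s, f z ∉ f '' U \ {f s} :=
    hf.continuousAt.eventually_mem (hfin.sdiff.isClosed.isOpen_compl.mem_nhds (by simp))
  obtain ⟨z, hz, hzs, hzU⟩ := ((hf.eventually_ne hf' (c := f s)).and
    ((hother.and hU).filter_mono nhdsWithin_le_nhds)).exists
  exact hzs ⟨mem_image_of_mem f hzU, hz⟩

/-- The parameters at which the primitive of the frontal `(γ, ν)` is defined. -/
def primitiveDomain (γ ν : ℝ → Plane) (I : Set ℝ) : Set ℝ := I ∩ {t | ⟪γ t, ν t⟫ ≠ 0}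

variable {γ ν : ℝ → Plane} {I : Set ℝ} {t : ℝ}

theorem ne_zero_of_mem_primitiveDomain (ht : t ∈ primitiveDomain γ ν I) : γ t ≠ 0 :=
  fun h => ht.2 (by rw [h, inner_zero_left])

theorem inner_primitivePoint_self (ht : t ∈ primitiveDomain γ ν I) :
    ⟪primitivePoint γ ν t, γ t⟫ = ‖γ t‖ ^ 2 := by
  rw [primitivePoint, inner_sub_left, real_inner_smul_left, real_inner_smul_left,
    real_inner_comm (γ t) (ν t), div_mul_cancel₀ _ ht.2, real_inner_self_eq_norm_sq]
  ring

theorem inner_primitivePoint_of_inner_eq_zero {w : Plane} (h : ⟪w, ν t⟫ = 0) :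
    ⟪primitivePoint γ ν t, w⟫ = 2 * ⟪γ t, w⟫ := by
  rw [primitivePoint, inner_sub_left, real_inner_smul_left, real_inner_smul_left,
    real_inner_comm w (ν t), h, mul_zero, sub_zero]

namespace IsLegendrianOn

theorem isOpen_primitiveDomain (h : IsLegendrianOn γ ν I) (hI : IsOpen I) :
    IsOpen (primitiveDomain γ ν I) :=
  (h.1.continuousOn.inner h.2.1.continuousOn).isOpen_inter_preimage hI isOpen_ne

theorem contDiffOn_primitivePoint (h : IsLegendrianOn γ ν I) :
    ContDiffOn ℝ ∞ (primitivePoint γ ν) (primitiveDomain γ ν I) := by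
  have hγ := h.1.mono (inter_subset_left : primitiveDomain γ ν I ⊆ I)
  have hν := h.2.1.mono (inter_subset_left : primitiveDomain γ ν I ⊆ I)
  exact ((contDiffOn_const (c := (2 : ℝ))).smul hγ).sub
    (((hγ.norm_sq ℝ).div (hγ.inner ℝ hν) fun t ht => ht.2).smul hν)

theorem hasDerivAt (h : IsLegendrianOn γ ν I) (hI : IsOpen I) (ht : t ∈ I) :
    HasDerivAt γ (deriv γ t) t :=
  ((h.1.differentiableOn (by simp)).differentiableAt (hI.mem_nhds ht)).hasDerivAt

theorem hasDerivAt_primitivePoint (h : IsLegendrianOn γ ν I) (hI : IsOpen I)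
    (ht : t ∈ primitiveDomain γ ν I) :
    HasDerivAt (primitivePoint γ ν) (deriv (primitivePoint γ ν) t) t :=
  ((h.contDiffOn_primitivePoint.differentiableOn (by simp)).differentiableAt
    ((h.isOpen_primitiveDomain hI).mem_nhds ht)).hasDerivAt

theorem inner_deriv_primitivePoint (h : IsLegendrianOn γ ν I) (hI : IsOpen I)
    (ht : t ∈ primitiveDomain γ ν I) : ⟪deriv (primitivePoint γ ν) t, γ t⟫ = 0 := by
  have hγ := h.hasDerivAt hI ht.1
  have heq : (fun s => ⟪primitivePoint γ ν s, γ s⟫) =ᶠ[𝓝 t] fun s => ‖γ s‖ ^ 2 :=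
    ((h.isOpen_primitiveDomain hI).eventually_mem ht).mono fun s => inner_primitivePoint_self
  have hderiv := ((h.hasDerivAt_primitivePoint hI ht).inner ℝ hγ).unique
    (hγ.norm_sq.congr_of_eventuallyEq heq)
  rw [inner_primitivePoint_of_inner_eq_zero (h.2.2 t ht.1).2] at hderiv
  linarith

theorem mem_zeroSet_limaconPoly (h : IsLegendrianOn γ ν I) (hI : IsOpen I) {a b r : ℝ}
    (hcirc : MapsTo (primitivePoint γ ν) (primitiveDomain γ ν I) (circle a b r))
    (ht : t ∈ primitiveDomain γ ν I) (hreg : deriv (primitivePoint γ ν) t ≠ 0) :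
    γ t ∈ zeroSet (limaconPoly a b r) := by
  have hconst : (fun s => ‖primitivePoint γ ν s - center a b‖ ^ 2) =ᶠ[𝓝 t] fun _ => r ^ 2 :=
    ((h.isOpen_primitiveDomain hI).eventually_mem ht).mono fun s hs => mem_circle.mp (hcirc hs)
  have hderiv := (((h.hasDerivAt_primitivePoint hI ht).sub_const (center a b)).norm_sq).unique
    ((hasDerivAt_const t (r ^ 2)).congr_of_eventuallyEq hconst)
  have hnormal : ⟪deriv (primitivePoint γ ν) t, primitivePoint γ ν t - center a b⟫ = 0 := by
    rw [real_inner_comm]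
    linarith
  rw [PlaneCurve.mem_zeroSet_limaconPoly, ← inner_primitivePoint_self ht, ← inner_sub_left,
    inner_sq_eq_of_inner_eq_zero hreg hnormal (h.inner_deriv_primitivePoint hI ht),
    mem_circle.mp (hcirc ht), inner_primitivePoint_self ht]

end IsLegendrianOn

/-- `(γ, ν)` is a nondegenerate frontal in `S` on the open parameter set `I`, as in the definition
of `primitive`. -/
structure IsFrontalIn (S : Set Plane) (γ ν : ℝ → Plane) (I : Set ℝ) : Prop where
  isOpen : IsOpen I
  isLegendrianOn : IsLegendrianOn γ ν I
  subset_closure : I ⊆ closure {s ∈ I | deriv γ s ≠ 0}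
  mapsTo : MapsTo γ I S

theorem mem_primitive {S : Set Plane} {q : Plane} : q ∈ primitive S ↔
    ∃ γ ν s₁ s₂, IsFrontalIn S γ ν (Ioo s₁ s₂) ∧
      q ∈ primitivePoint γ ν '' primitiveDomain γ ν (Ioo s₁ s₂) := by
  constructor
  · rintro ⟨γ, ν, s₁, s₂, t, hL, hd, hS, ht, ht', rfl⟩
    exact ⟨γ, ν, s₁, s₂, ⟨isOpen_Ioo, hL, hd, hS⟩, t, ⟨ht, ht'⟩, rfl⟩
  · rintro ⟨γ, ν, s₁, s₂, h, t, ⟨ht, ht'⟩, rfl⟩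
    exact ⟨γ, ν, s₁, s₂, t, h.isLegendrianOn, h.subset_closure, h.mapsTo, ht, ht', rfl⟩

variable {S : Set Plane} {F : MvPolynomial (Fin 2) ℝ}

namespace IsFrontalIn

theorem isOpen_primitiveDomain (h : IsFrontalIn S γ ν I) : IsOpen (primitiveDomain γ ν I) :=
  h.isLegendrianOn.isOpen_primitiveDomain h.isOpen

theorem infinite_image (h : IsFrontalIn S γ ν I) {U : Set ℝ} (hU : IsOpen U) (hUI : U ⊆ I)
    (hne : U.Nonempty) : (γ '' U).Infinite := by
  obtain ⟨t, ht⟩ := hne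
  obtain ⟨s, hsU, hsI, hs⟩ := mem_closure_iff.mp (h.subset_closure (hUI ht)) U hU ht
  exact infinite_image_of_hasDerivAt (h.isLegendrianOn.hasDerivAt h.isOpen hsI) hs
    (hU.mem_nhds hsU)

theorem mapsTo_zeroSet (h : IsFrontalIn S γ ν I) (hS : S ⊆ insert 0 (zeroSet F)) :
    MapsTo γ (primitiveDomain γ ν I) (zeroSet F) := fun _ ht =>
  (hS (h.mapsTo ht.1)).resolve_left (ne_zero_of_mem_primitiveDomain ht)

theorem dvd_of_mapsTo (h : IsFrontalIn S γ ν I) (hF : Irreducible F)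
    (hS : S ⊆ insert 0 (zeroSet F)) {V : Set ℝ} (hV : IsOpen V) (hVD : V ⊆ primitiveDomain γ ν I)
    (hne : V.Nonempty) {G : MvPolynomial (Fin 2) ℝ} (hG : MapsTo γ V (zeroSet G)) : F ∣ G :=
  dvd_of_infinite hF (h.infinite_image hV (hVD.trans inter_subset_left) hne)
    ((h.mapsTo_zeroSet hS).mono_left hVD).image_subset hG.image_subset

theorem dvd_limaconPoly (h : IsFrontalIn S γ ν I) (hF : Irreducible F)
    (hS : S ⊆ insert 0 (zeroSet F)) {a b r : ℝ}
    (hcirc : MapsTo (primitivePoint γ ν) (primitiveDomain γ ν I) (circle a b r))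
    (ht : t ∈ primitiveDomain γ ν I) (hreg : deriv (primitivePoint γ ν) t ≠ 0) :
    F ∣ limaconPoly a b r := by
  have hopen : IsOpen (primitiveDomain γ ν I ∩ {s | deriv (primitivePoint γ ν) s ≠ 0}) :=
    (h.isLegendrianOn.contDiffOn_primitivePoint.continuousOn_deriv_of_isOpen
      h.isOpen_primitiveDomain (by simp)).isOpen_inter_preimage h.isOpen_primitiveDomain isOpen_ne
  exact h.dvd_of_mapsTo hF hS hopen inter_subset_left ⟨t, ht, hreg⟩ fun s hs =>
    h.isLegendrianOn.mem_zeroSet_limaconPoly h.isOpen hcirc hs.1 hs.2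

theorem dvd_diameterPoly (h : IsFrontalIn S γ ν I) (hF : Irreducible F)
    (hS : S ⊆ insert 0 (zeroSet F))
    (hderiv : ∀ s ∈ primitiveDomain γ ν I, deriv (primitivePoint γ ν) s = 0)
    (ht : t ∈ primitiveDomain γ ν I) : F ∣ diameterPoly (primitivePoint γ ν t) := by
  have hopen : IsOpen (primitiveDomain γ ν I ∩ primitivePoint γ ν ⁻¹' {primitivePoint γ ν t}) :=
    h.isOpen_primitiveDomain.isOpen_inter_preimage_of_deriv_eq_zero
      (h.isLegendrianOn.contDiffOn_primitivePoint.differentiableOn (by simp)) hderiv _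
  refine h.dvd_of_mapsTo hF hS hopen inter_subset_left ⟨t, ht, rfl⟩ fun s hs => ?_
  rw [mem_zeroSet_diameterPoly, ← inner_primitivePoint_self hs.1, hs.2]

end IsFrontalIn

theorem infinite_zeroSet_of_nonempty_primitive (hS : S ⊆ insert 0 (zeroSet F))
    (hne : (primitive S).Nonempty) : (zeroSet F).Infinite := by
  obtain ⟨q, hq⟩ := hne
  obtain ⟨γ, ν, s₁, s₂, h, t, ht, -⟩ := mem_primitive.mp hq
  exact (h.infinite_image h.isOpen_primitiveDomain inter_subset_left ⟨t, ht⟩).mono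
    (h.mapsTo_zeroSet hS).image_subset

theorem zeroSet_subset_of_dvd {G : MvPolynomial (Fin 2) ℝ} (h : F ∣ G) : zeroSet F ⊆ zeroSet G := by
  obtain ⟨H, rfl⟩ := h
  intro p hp
  rw [mem_zeroSet, map_mul, mem_zeroSet.mp hp, zero_mul]

theorem eq_of_dvd_diameterPoly (hF : (zeroSet F).Infinite) {q q' : Plane}
    (hq : F ∣ diameterPoly q) (hq' : F ∣ diameterPoly q') : q = q' := by
  by_contra hne
  have hmem {s : Plane} (hs : F ∣ diameterPoly s) {p : Plane} (hp : p ∈ zeroSet F \ {0}) :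
      ‖p‖ ^ 2 = ⟪s, p⟫ :=
    mem_zeroSet_diameterPoly.mp (zeroSet_subset_of_dvd hs hp.1)
  have hsub : (zeroSet F \ {0}).Subsingleton := fun x hx y hy =>
    eq_of_norm_sq_eq_inner hne hx.2 hy.2 (hmem hq hx) (hmem hq' hx) (hmem hq hy) (hmem hq' hy)
  exact hF.sdiff (finite_singleton 0) hsub.finite

theorem dvd_limaconPoly_of_primitive_subset (hF : Irreducible F)
    (hS : S ⊆ insert 0 (zeroSet F)) {a b r : ℝ} (hsub : primitive S ⊆ circle a b r)
    (hnt : (primitive S).Nontrivial) : F ∣ limaconPoly a b r := by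
  by_contra hndvd
  have hdiam : ∀ q ∈ primitive S, F ∣ diameterPoly q := by
    intro q hq
    obtain ⟨γ, ν, s₁, s₂, h, t, ht, rfl⟩ := mem_primitive.mp hq
    refine h.dvd_diameterPoly hF hS (fun s hs => ?_) ht
    by_contra hreg
    exact hndvd (h.dvd_limaconPoly hF hS
      (fun x hx => hsub (mem_primitive.mpr ⟨γ, ν, s₁, s₂, h, x, hx, rfl⟩)) hs hreg)
  obtain ⟨q, hq, q', hq', hne⟩ := hnt
  exact hne (eq_of_dvd_diameterPoly (infinite_zeroSet_of_nonempty_primitive hS ⟨q, hq⟩)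
    (hdiam q hq) (hdiam q' hq'))

theorem nontrivial_of_closure_eq_circle {a b r : ℝ} (hr : r ≠ 0)
    (h : closure S = circle a b r) : S.Nontrivial := by
  rw [← not_subsingleton_iff]
  intro hS
  have hright : (!₂[a + r, b] : Plane) ∈ closure S := by simp [h, circle]
  have hleft : (!₂[a - r, b] : Plane) ∈ closure S := by simp [h, circle]
  have heq : a + r = a - r := congrArg (fun p : Plane => p 0) (hS.closure hright hleft)
  exact hr (by linarith)

theorem ne_zero_of_nontrivial_circle {a b r : ℝ} (h : (circle a b r).Nontrivial) : r ≠ 0 := by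
  rintro rfl
  refine not_subsingleton_iff.mpr h (subsingleton_of_forall_eq (center a b) fun p hp => ?_)
  simpa [sub_eq_zero] using mem_circle.mp hp

end Frontal

section Polar

open Set Module
open scoped RealInnerProductSpace EuclideanSpace

theorem norm_sq_eq_of_orthonormal {E : Type*} [NormedAddCommGroup E] [InnerProductSpace ℝ E]
    [Fact (finrank ℝ E = 2)] {u v : E} (huv : Orthonormal ℝ ![u, v]) (p : E) :
    ‖p‖ ^ 2 = ⟪u, p⟫ ^ 2 + ⟪v, p⟫ ^ 2 := by
  have hcard : Fintype.card (Fin 2) = finrank ℝ E := by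
    rw [Fintype.card_fin, Fact.out (p := finrank ℝ E = 2)]
  have hspan := (basisOfOrthonormalOfCardEqFinrank huv hcard).span_eq
  rw [coe_basisOfOrthonormalOfCardEqFinrank] at hspan
  simpa [Fin.sum_univ_two] using
    ((OrthonormalBasis.mk huv hspan.ge).sum_sq_norm_inner_right p).symm

theorem eq_zero_of_inner_eq_zero {E : Type*} [NormedAddCommGroup E] [InnerProductSpace ℝ E]
    [Fact (finrank ℝ E = 2)] {u v : E} (huv : Orthonormal ℝ ![u, v]) {w : E} (hu : ⟪u, w⟫ = 0)
    (hv : ⟪v, w⟫ = 0) : w = 0 := by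
  rw [← norm_eq_zero, ← sq_eq_zero_iff, norm_sq_eq_of_orthonormal huv, hu, hv]
  simp

theorem orthonormal_pair {E : Type*} [NormedAddCommGroup E] [InnerProductSpace ℝ E] {u v : E} :
    Orthonormal ℝ ![u, v] ↔ ‖u‖ = 1 ∧ ‖v‖ = 1 ∧ ⟪u, v⟫ = 0 := by
  simp [orthonormal_vecCons_iff, and_comm]

/-- The unit vector at the angle `θ` to the first axis. -/
def polarVec (θ : ℝ) : Plane := !₂[Real.cos θ, Real.sin θ]

theorem norm_polarVec (θ : ℝ) : ‖polarVec θ‖ = 1 := by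
  rw [← sq_eq_sq₀ (norm_nonneg _) zero_le_one, norm_sq_plane, one_pow]
  exact Real.cos_sq_add_sin_sq θ

theorem polarVec_add_pi (θ : ℝ) : polarVec (θ + Real.pi) = -polarVec θ := by
  ext i
  fin_cases i <;> simp [polarVec]

theorem polarVec_add_pi_div_two (θ : ℝ) :
    polarVec (θ + Real.pi / 2) = !₂[-Real.sin θ, Real.cos θ] := by
  rw [polarVec, Real.cos_add_pi_div_two, Real.sin_add_pi_div_two]

theorem orthonormal_polarVec (θ : ℝ) :
    Orthonormal ℝ ![polarVec θ, polarVec (θ + Real.pi / 2)] := by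
  refine orthonormal_pair.mpr ⟨norm_polarVec θ, norm_polarVec _, ?_⟩
  rw [polarVec_add_pi_div_two, inner_plane]
  simp [polarVec, mul_comm]

theorem hasDerivAt_polarVec (θ : ℝ) : HasDerivAt polarVec (polarVec (θ + Real.pi / 2)) θ := by
  rw [polarVec_add_pi_div_two]
  refine (EuclideanSpace.equiv (Fin 2) ℝ).symm.hasFDerivAt.comp_hasDerivAt θ
    (f := fun θ => ![Real.cos θ, Real.sin θ]) (hasDerivAt_pi.mpr fun i => ?_)
  fin_cases i
  exacts [Real.hasDerivAt_cos θ, Real.hasDerivAt_sin θ]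

theorem contDiff_polarVec {n : WithTop ℕ∞} : ContDiff ℝ n polarVec := by
  refine contDiff_euclidean.mpr fun i => ?_
  fin_cases i
  exacts [Real.contDiff_cos, Real.contDiff_sin]

theorem exists_eq_norm_smul_polarVec (p : Plane) : ∃ θ, p = ‖p‖ • polarVec θ := by
  have hnorm : ‖p‖ = ‖(⟨p 0, p 1⟩ : ℂ)‖ := by
    rw [EuclideanSpace.norm_eq, Fin.sum_univ_two, Complex.norm_eq_sqrt_sq_add_sq]
    simp
  refine ⟨Complex.arg ⟨p 0, p 1⟩, ?_⟩
  rw [hnorm]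
  ext i
  fin_cases i
  exacts [(Complex.norm_mul_cos_arg ⟨p 0, p 1⟩).symm, (Complex.norm_mul_sin_arg ⟨p 0, p 1⟩).symm]

theorem exists_orthonormal_eq_norm_smul (c : Plane) :
    ∃ u v : Plane, Orthonormal ℝ ![u, v] ∧ c = ‖c‖ • v := by
  obtain ⟨θ, hθ⟩ := exists_eq_norm_smul_polarVec c
  exact ⟨_, _, by simpa using orthonormal_polarVec (θ - Real.pi / 2), hθ⟩

end Polar

section Limacon

open Set
open scoped RealInnerProductSpace EuclideanSpace

variable {a b r θ : ℝ}

/-- The signed distance from the origin to the tangent line of the circle with center `c` and radius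
`r` at its point in direction `θ`. -/
def supportFunction (c : Plane) (r θ : ℝ) : ℝ := r + ⟪c, polarVec θ⟫

theorem limacon_eq_smul_polarVec (a b r θ : ℝ) :
    limacon a b r θ = supportFunction (center a b) r θ • polarVec θ := by
  rw [supportFunction, inner_center]
  ext i
  fin_cases i <;> simp [limacon, polarVec, add_assoc]

theorem norm_limacon : ‖limacon a b r θ‖ = |supportFunction (center a b) r θ| := by
  rw [limacon_eq_smul_polarVec, norm_smul, norm_polarVec, mul_one, Real.norm_eq_abs]

theorem limacon_mem_zeroSet : limacon a b r θ ∈ zeroSet (limaconPoly a b r) := by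
  rw [mem_zeroSet_limaconPoly, norm_limacon, sq_abs, limacon_eq_smul_polarVec,
    real_inner_smul_right, supportFunction]
  ring

theorem mem_range_limacon {p : Plane} (hp : p ∈ zeroSet (limaconPoly a b r)) (hp0 : p ≠ 0) :
    p ∈ range (limacon a b r) := by
  obtain ⟨θ, hθ⟩ := exists_eq_norm_smul_polarVec p
  have hsq : (‖p‖ - ⟪center a b, polarVec θ⟫) ^ 2 = r ^ 2 := by
    rw [mem_zeroSet_limaconPoly, hθ, real_inner_smul_right, ← hθ] at hp
    refine mul_left_cancel₀ (pow_ne_zero 2 (norm_ne_zero_iff.mpr hp0)) ?_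
    linear_combination hp
  rcases sq_eq_sq_iff_eq_or_eq_neg.mp hsq with h | h
  · refine ⟨θ, ?_⟩
    rw [limacon_eq_smul_polarVec, supportFunction, ← h, sub_add_cancel, ← hθ]
  · refine ⟨θ + Real.pi, ?_⟩
    rw [limacon_eq_smul_polarVec, supportFunction, polarVec_add_pi, inner_neg_right, smul_neg,
      ← neg_smul, neg_add, ← h, neg_neg, sub_add_cancel, ← hθ]

theorem continuous_supportFunction (c : Plane) (r : ℝ) : Continuous (supportFunction c r) :=
  continuous_const.add (continuous_const.inner (contDiff_polarVec (n := 0)).continuous)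

theorem exists_supportFunction_eq_zero {c : Plane} (h : r ^ 2 ≤ ‖c‖ ^ 2) :
    ∃ θ, supportFunction c r θ = 0 := by
  obtain ⟨θ, hθ⟩ := exists_eq_norm_smul_polarVec c
  have hinner : ⟪c, polarVec θ⟫ = ‖c‖ := by
    rw [hθ, real_inner_smul_left, ← hθ, real_inner_self_eq_norm_sq, norm_polarVec, one_pow, mul_one]
  obtain ⟨hlow, hup⟩ := abs_le.mp ((sq_le_sq.mp h).trans_eq (abs_norm c))
  refine mem_range_of_exists_le_of_exists_ge (continuous_supportFunction c r)
    ⟨θ + Real.pi, ?_⟩ ⟨θ, ?_⟩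
  · rw [supportFunction, polarVec_add_pi, inner_neg_right, hinner]
    linarith
  · rw [supportFunction, hinner]
    linarith

theorem supportFunction_ne_zero {c : Plane} (h : ‖c‖ ^ 2 < r ^ 2) : supportFunction c r θ ≠ 0 := by
  refine fun h0 => h.not_ge ?_
  rw [eq_neg_of_add_eq_zero_left h0, neg_sq, norm_sq_eq_of_orthonormal (orthonormal_polarVec θ),
    real_inner_comm]
  exact le_add_of_nonneg_right (sq_nonneg _)

theorem zeroSet_limaconPoly_eq_range (h : r ^ 2 ≤ a ^ 2 + b ^ 2) :
    zeroSet (limaconPoly a b r) = range (limacon a b r) := by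
  refine Subset.antisymm (fun p hp => ?_) (range_subset_iff.mpr fun θ => limacon_mem_zeroSet)
  rcases eq_or_ne p 0 with rfl | hp0
  · obtain ⟨θ, hθ⟩ := exists_supportFunction_eq_zero (h.trans_eq (norm_center_sq a b).symm)
    exact ⟨θ, by rw [limacon_eq_smul_polarVec, hθ, zero_smul]⟩
  · exact mem_range_limacon hp hp0

theorem zeroSet_limaconPoly_sdiff_zero_eq_range (h : a ^ 2 + b ^ 2 < r ^ 2) :
    zeroSet (limaconPoly a b r) \ {0} = range (limacon a b r) := by
  refine Subset.antisymm (fun p hp => mem_range_limacon hp.1 hp.2)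
    (range_subset_iff.mpr fun θ => ⟨limacon_mem_zeroSet, ?_⟩)
  rw [mem_singleton_iff, ← norm_eq_zero, norm_limacon, abs_eq_zero]
  exact supportFunction_ne_zero ((norm_center_sq a b).trans_lt h)

theorem hasDerivAt_limacon (a b r θ : ℝ) : HasDerivAt (limacon a b r)
    (supportFunction (center a b) r θ • polarVec (θ + Real.pi / 2)
      + ⟪center a b, polarVec (θ + Real.pi / 2)⟫ • polarVec θ) θ := by
  have hsupport : HasDerivAt (supportFunction (center a b) r)
      ⟪center a b, polarVec (θ + Real.pi / 2)⟫ θ := by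
    refine (((hasDerivAt_const θ (center a b)).inner ℝ (hasDerivAt_polarVec θ)).const_add
      r).congr_deriv ?_
    rw [inner_zero_left, add_zero]
  rw [funext (limacon_eq_smul_polarVec a b r)]
  exact hsupport.smul (hasDerivAt_polarVec θ)

theorem deriv_limacon_ne_zero (h : a ^ 2 + b ^ 2 ≠ r ^ 2) (θ : ℝ) :
    deriv (limacon a b r) θ ≠ 0 := by
  rw [(hasDerivAt_limacon a b r θ).deriv]
  intro h0
  have hindep : LinearIndependent ℝ ![polarVec θ, polarVec (θ + Real.pi / 2)] :=
    (orthonormal_polarVec θ).linearIndependent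
  obtain ⟨hradial, hsupport⟩ := LinearIndependent.pair_iff.mp hindep _ _
    ((add_comm _ _).trans h0)
  refine h ?_
  rw [← norm_center_sq, norm_sq_eq_of_orthonormal (orthonormal_polarVec θ), real_inner_comm,
    eq_neg_of_add_eq_zero_right hsupport, real_inner_comm, hradial]
  ring

end Limacon

section Front

open Set
open scoped RealInnerProductSpace EuclideanSpace

theorem isFrontOn_of_deriv_ne_zero {γ : ℝ → Plane} {I : Set ℝ} (hI : IsOpen I)
    (hγ : ContDiffOn ℝ ∞ γ I) (hreg : ∀ t ∈ I, deriv γ t ≠ 0) : IsFrontOn γ I := by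
  let J := (EuclideanSpace.basisFun (Fin 2) ℝ).toBasis.orientation.rightAngleRotation
  have hγ' : ContDiffOn ℝ ∞ (deriv γ) I := hγ.deriv_of_isOpen hI (by simp)
  refine ⟨fun t => ‖deriv γ t‖⁻¹ • J (deriv γ t), ⟨hγ, ?_, fun t ht => ⟨?_, ?_⟩⟩,
    fun t ht => Or.inl (hreg t ht)⟩
  · exact ((hγ'.norm ℝ hreg).inv fun t ht => norm_ne_zero_iff.mpr (hreg t ht)).smul
      (J.contDiff.comp_contDiffOn hγ')
  · rw [norm_smul, norm_inv, norm_norm, J.norm_map,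
      inv_mul_cancel₀ (norm_ne_zero_iff.mpr (hreg t ht))]
  · rw [real_inner_smul_right, real_inner_comm, Orientation.inner_rightAngleRotation_self, mul_zero]

theorem isFrontOn_limacon {a b r : ℝ} (h : a ^ 2 + b ^ 2 ≠ r ^ 2) :
    IsFrontOn (limacon a b r) univ := by
  refine isFrontOn_of_deriv_ne_zero isOpen_univ ?_ fun θ _ => deriv_limacon_ne_zero h θ
  rw [funext (limacon_eq_smul_polarVec a b r)]
  exact ((contDiff_const.add (contDiff_const.inner ℝ contDiff_polarVec)).smul
    contDiff_polarVec).contDiffOn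

end Front

section LocalDiffeomorphism

open Set Filter Topology
open scoped RealInnerProductSpace EuclideanSpace

theorem exists_openPartialHomeomorph_contDiffOn {E : Type*} [NormedAddCommGroup E]
    [NormedSpace ℝ E] [CompleteSpace E] {f : E → E} {e : E ≃L[ℝ] E} {p : E} {n : WithTop ℕ∞}
    (hn : n ≠ 0) (hn' : n ≠ ∞) (hf : ContDiffAt ℝ n f p) (he : HasFDerivAt f (e : E →L[ℝ] E) p) :
    ∃ Φ : OpenPartialHomeomorph E E, p ∈ Φ.source ∧ ⇑Φ = f ∧ ContDiffOn ℝ n Φ Φ.source ∧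
      ContDiffOn ℝ n Φ.symm Φ.target :=
  let Φ := hf.toOpenPartialHomeomorph f he hn
  ⟨Φ.restrContDiff ℝ n hn',
    ⟨hf.mem_toOpenPartialHomeomorph_source he hn, hf, hf.to_localInverse he hn⟩, rfl,
    Φ.contDiffOn_restrContDiff_source ℝ hn', Φ.contDiffOn_restrContDiff_target ℝ hn'⟩

theorem LocallyDiffeomorphicAt.of_hasFDerivAt {f : Plane → Plane} {f' : Plane →L[ℝ] Plane}
    {p : Plane} (hf : ContDiffAt ℝ ω f p) (hf' : HasFDerivAt f f' p)
    (hinj : Function.Injective f') {S T : Set Plane} (hST : ∀ᶠ x in 𝓝 p, x ∈ S ↔ f x ∈ T) :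
    LocallyDiffeomorphicAt S p T (f p) := by
  let e : Plane ≃L[ℝ] Plane :=
    (LinearEquiv.ofInjectiveEndo (f' : Plane →ₗ[ℝ] Plane) hinj).toContinuousLinearEquiv
  have he : HasFDerivAt f (e : Plane →L[ℝ] Plane) p := hf'
  obtain ⟨Φ, hpΦ, rfl, hΦ, hΦsymm⟩ :=
    exists_openPartialHomeomorph_contDiffOn (by simp) (by simp) hf he
  obtain ⟨V, hV, hVo, hpV⟩ := eventually_nhds_iff.mp hST
  have himage : (Φ.restrOpen V hVo).IsImage S T := fun x hx => (hV x hx.2).symm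
  refine ⟨Φ.restrOpen V hVo, ⟨hpΦ, hpV⟩, rfl, (hΦ.mono inter_subset_left).of_le le_top,
    (hΦsymm.mono inter_subset_left).of_le le_top, ?_⟩
  rw [inter_comm S, inter_comm T]
  exact himage.image_eq

theorem LocallyDiffeomorphicAt.of_hasFDerivAt_pair {g₁ g₂ : Plane → ℝ} {L₁ L₂ : Plane →L[ℝ] ℝ}
    {p : Plane} (hg₁ : ContDiffAt ℝ ω g₁ p) (hg₂ : ContDiffAt ℝ ω g₂ p)
    (hL₁ : HasFDerivAt g₁ L₁ p) (hL₂ : HasFDerivAt g₂ L₂ p)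
    (hL : ∀ w, L₁ w = 0 → L₂ w = 0 → w = 0) {S T : Set Plane}
    (hST : ∀ᶠ x in 𝓝 p, x ∈ S ↔ !₂[g₁ x, g₂ x] ∈ T) {q : Plane} (hq : !₂[g₁ p, g₂ p] = q) :
    LocallyDiffeomorphicAt S p T q := by
  subst hq
  let f' : Plane →L[ℝ] Plane :=
    (EuclideanSpace.equiv (Fin 2) ℝ).symm.toContinuousLinearMap.comp
      (ContinuousLinearMap.pi ![L₁, L₂])
  have hinj : Function.Injective f' := (injective_iff_map_eq_zero f').mpr fun w hw =>
    hL w (congrFun (congrArg WithLp.ofLp hw) 0) (congrFun (congrArg WithLp.ofLp hw) 1)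
  refine of_hasFDerivAt (f := fun x => !₂[g₁ x, g₂ x]) (f' := f')
    (contDiffAt_euclidean.mpr fun i => ?_) ?_ hinj hST
  · fin_cases i
    exacts [hg₁, hg₂]
  · refine (EuclideanSpace.equiv (Fin 2) ℝ).symm.hasFDerivAt.comp p
      (f := fun x => ![g₁ x, g₂ x]) (hasFDerivAt_pi.mpr fun i => ?_)
    fin_cases i
    exacts [hL₁, hL₂]

theorem hasFDerivAt_clm_mul_zero {E : Type*} [NormedAddCommGroup E] [NormedSpace ℝ E]
    (L : E →L[ℝ] ℝ) {h : E → ℝ} (hh : ContDiffAt ℝ ω h 0) :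
    HasFDerivAt (fun x => L x * h x) (h 0 • L) 0 := by
  refine (L.hasFDerivAt.mul (hh.differentiableAt (by simp)).hasFDerivAt).congr_fderiv ?_
  rw [map_zero, zero_smul, zero_add]

theorem mem_range_cusp {p : Plane} :
    p ∈ range (fun t : ℝ => (!₂[t ^ 2, t ^ 3] : Plane)) ↔ p 1 ^ 2 = p 0 ^ 3 := by
  constructor
  · rintro ⟨t, rfl⟩
    exact (pow_mul t 3 2).symm.trans (pow_mul t 2 3)
  · intro h
    have h0 : (p 1 / p 0) ^ 2 = p 0 := by
      rcases eq_or_ne (p 0) 0 with hp | hp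
      · rw [hp, div_zero, zero_pow two_ne_zero]
      · rw [div_pow, h, pow_succ (p 0) 2, mul_div_cancel_left₀ _ (pow_ne_zero 2 hp)]
    have h1 : (p 1 / p 0) ^ 3 = p 1 := by
      rw [pow_succ, h0]
      refine mul_div_cancel_of_imp' fun hp => ?_
      rwa [hp, zero_pow three_ne_zero, sq_eq_zero_iff] at h
    refine ⟨p 1 / p 0, ?_⟩
    ext i
    fin_cases i
    exacts [h0, h1]

variable {x y : Plane →L[ℝ] ℝ} {A B : Plane → ℝ} {S : Set Plane}

theorem hasOrdinaryCuspAt_zero (hxy : ∀ w, x w = 0 → y w = 0 → w = 0)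
    (hA : ContDiffAt ℝ ω A 0) (hB : ContDiffAt ℝ ω B 0) (hA0 : 0 < A 0) (hB0 : B 0 ≠ 0)
    (hS : ∀ᶠ p in 𝓝 0, p ∈ S ↔ x p ^ 2 * A p = y p ^ 3 * B p) : HasOrdinaryCuspAt S 0 := by
  have hsqrt : ContDiffAt ℝ ω (fun p => B p * √(A p)) 0 := hB.mul (hA.sqrt hA0.ne')
  have hmem : ∀ᶠ p in 𝓝 0, p ∈ S ↔
      !₂[y p * B p, x p * (B p * √(A p))] ∈ range (fun t : ℝ => (!₂[t ^ 2, t ^ 3] : Plane)) := by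
    filter_upwards [hS, hA.continuousAt.eventually (lt_mem_nhds hA0),
      hB.continuousAt.eventually_ne hB0] with p hp hAp hBp
    have hsq : (x p * (B p * √(A p))) ^ 2 = B p ^ 2 * (x p ^ 2 * A p) := by
      rw [mul_pow, mul_pow, Real.sq_sqrt hAp.le]
      ring
    have hcube : (y p * B p) ^ 3 = B p ^ 2 * (y p ^ 3 * B p) := by ring
    rw [hp, mem_range_cusp]
    change _ ↔ (x p * (B p * √(A p))) ^ 2 = (y p * B p) ^ 3
    rw [hsq, hcube, mul_right_inj' (pow_ne_zero 2 hBp)]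
  refine LocallyDiffeomorphicAt.of_hasFDerivAt_pair (y.contDiff.contDiffAt.mul hB)
    (x.contDiff.contDiffAt.mul hsqrt) (hasFDerivAt_clm_mul_zero y hB)
    (hasFDerivAt_clm_mul_zero x hsqrt) (fun w hyw hxw => ?_) hmem ?_
  · exact hxy w ((mul_eq_zero_iff_left (mul_ne_zero hB0 (Real.sqrt_pos.mpr hA0).ne')).mp hxw)
      ((mul_eq_zero_iff_left hB0).mp hyw)
  · ext i
    fin_cases i <;> simp

theorem hasNodeAt_zero (hxy : ∀ w, x w = 0 → y w = 0 → w = 0)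
    (hA : ContDiffAt ℝ ω A 0) (hB : ContDiffAt ℝ ω B 0) (hA0 : 0 < A 0) (hB0 : 0 < B 0)
    (hS : ∀ᶠ p in 𝓝 0, p ∈ S ↔ x p ^ 2 * A p = y p ^ 2 * B p) : HasNodeAt S 0 := by
  have hsqrtA : ContDiffAt ℝ ω (fun p => √(A p)) 0 := hA.sqrt hA0.ne'
  have hsqrtB : ContDiffAt ℝ ω (fun p => √(B p)) 0 := hB.sqrt hB0.ne'
  have hmem : ∀ᶠ p in 𝓝 0, p ∈ S ↔
      !₂[x p * √(A p) + y p * √(B p), x p * √(A p) - y p * √(B p)]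
        ∈ {z : Plane | z 0 * z 1 = 0} := by
    filter_upwards [hS, hA.continuousAt.eventually (lt_mem_nhds hA0),
      hB.continuousAt.eventually (lt_mem_nhds hB0)] with p hp hAp hBp
    change _ ↔ (x p * √(A p) + y p * √(B p)) * (x p * √(A p) - y p * √(B p)) = 0
    rw [hp, ← sq_sub_sq, mul_pow, mul_pow, Real.sq_sqrt hAp.le, Real.sq_sqrt hBp.le, sub_eq_zero]
  have hdx := hasFDerivAt_clm_mul_zero x hsqrtA
  have hdy := hasFDerivAt_clm_mul_zero y hsqrtB
  have hx := x.contDiff.contDiffAt.mul hsqrtA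
  have hy := y.contDiff.contDiffAt.mul hsqrtB
  refine LocallyDiffeomorphicAt.of_hasFDerivAt_pair (hx.add hy) (hx.sub hy) (hdx.add hdy)
    (hdx.sub hdy) (fun w hadd hsub => ?_) hmem ?_
  · have hadd' : √(A 0) * x w + √(B 0) * y w = 0 := hadd
    have hsub' : √(A 0) * x w - √(B 0) * y w = 0 := hsub
    exact hxy w
      ((mul_eq_zero_iff_left (Real.sqrt_pos.mpr hA0).ne').mp (by linarith))
      ((mul_eq_zero_iff_left (Real.sqrt_pos.mpr hB0).ne').mp (by linarith))
  · ext i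
    fin_cases i <;> simp

end LocalDiffeomorphism

section Singularity

open Set
open scoped RealInnerProductSpace EuclideanSpace

variable {a b r : ℝ} {u v : Plane}

theorem mem_zeroSet_limaconPoly_frame (huv : Orthonormal ℝ ![u, v]) {d : ℝ}
    (hc : center a b = d • v) {p : Plane} : p ∈ zeroSet (limaconPoly a b r) ↔
      (⟪u, p⟫ ^ 2 + ⟪v, p⟫ ^ 2 - d * ⟪v, p⟫) ^ 2 = r ^ 2 * (⟪u, p⟫ ^ 2 + ⟪v, p⟫ ^ 2) := by
  rw [mem_zeroSet_limaconPoly, norm_sq_eq_of_orthonormal huv, hc, real_inner_smul_left]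

theorem hasOrdinaryCuspAt_limacon (hr : r ≠ 0) (h : a ^ 2 + b ^ 2 = r ^ 2) :
    HasOrdinaryCuspAt (zeroSet (limaconPoly a b r)) 0 := by
  obtain ⟨u, v, huv, hc⟩ := exists_orthonormal_eq_norm_smul (center a b)
  have hd2 : ‖center a b‖ ^ 2 = r ^ 2 := (norm_center_sq a b).trans h
  have hd0 : ‖center a b‖ ≠ 0 := fun h0 => hr (by simpa [h0] using hd2.symm)
  set d := ‖center a b‖
  refine hasOrdinaryCuspAt_zero (x := innerSL ℝ u) (y := innerSL ℝ v)
    (A := fun p => d ^ 2 + 2 * d * innerSL ℝ v p - 2 * innerSL ℝ v p ^ 2 - innerSL ℝ u p ^ 2)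
    (B := fun p => innerSL ℝ v p - 2 * d) (fun w => eq_zero_of_inner_eq_zero huv)
    (ContDiff.contDiffAt (by fun_prop)) (ContDiff.contDiffAt (by fun_prop)) ?_ ?_
    (.of_forall fun p => ?_)
  · simpa using pow_pos (norm_pos_iff.mpr (norm_ne_zero_iff.mp hd0)) 2
  · simpa using hd0
  · rw [mem_zeroSet_limaconPoly_frame huv hc, ← hd2, innerSL_apply_apply, innerSL_apply_apply]
    constructor <;> intro hp <;> linear_combination -hp

theorem hasNodeAt_limacon (hr : r ≠ 0) (h : r ^ 2 < a ^ 2 + b ^ 2) :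
    HasNodeAt (zeroSet (limaconPoly a b r)) 0 := by
  obtain ⟨u, v, huv, hc⟩ := exists_orthonormal_eq_norm_smul (center a b)
  have hd2 : r ^ 2 < ‖center a b‖ ^ 2 := h.trans_eq (norm_center_sq a b).symm
  set d := ‖center a b‖
  refine hasNodeAt_zero (x := innerSL ℝ u) (y := innerSL ℝ v)
    (A := fun p => r ^ 2 + 2 * d * innerSL ℝ v p - (innerSL ℝ u p ^ 2 + innerSL ℝ v p ^ 2))
    (B := fun p => d ^ 2 - r ^ 2 - 2 * d * innerSL ℝ v p + (innerSL ℝ u p ^ 2 + innerSL ℝ v p ^ 2))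
    (fun w => eq_zero_of_inner_eq_zero huv)
    (ContDiff.contDiffAt (by fun_prop)) (ContDiff.contDiffAt (by fun_prop)) ?_ ?_
    (.of_forall fun p => ?_)
  · simpa using sq_pos_of_ne_zero hr
  · simpa using hd2
  · rw [mem_zeroSet_limaconPoly_frame huv hc, innerSL_apply_apply, innerSL_apply_apply]
    constructor <;> intro hp <;> linear_combination -hp

theorem isIsolatedPointOf_limacon (h : a ^ 2 + b ^ 2 < r ^ 2) :
    IsIsolatedPointOf (zeroSet (limaconPoly a b r)) 0 := by
  refine ⟨Metric.ball (center a b) |r|, Metric.isOpen_ball, Subset.antisymm (fun p hp => ?_) ?_⟩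
  · by_contra hp0
    have hdist : |‖p‖ ^ 2 - ⟪center a b, p⟫| ≤ ‖p - center a b‖ * ‖p‖ := by
      rw [← real_inner_self_eq_norm_sq, ← inner_sub_left]
      exact abs_real_inner_le_norm _ _
    have heq : |‖p‖ ^ 2 - ⟪center a b, p⟫| = |r| * ‖p‖ := by
      rw [← abs_norm p, ← abs_mul, ← sq_eq_sq_iff_abs_eq_abs, mul_pow, abs_norm]
      exact mem_zeroSet_limaconPoly.mp hp.1
    exact (mem_ball_iff_norm.mp hp.2).not_ge
      (le_of_mul_le_mul_right (heq.symm.trans_le hdist) (norm_pos_iff.mpr hp0))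
  · rintro _ rfl
    refine ⟨zero_mem_zeroSet_limaconPoly a b r, ?_⟩
    rw [mem_ball_iff_norm, zero_sub, norm_neg, ← abs_norm, ← sq_lt_sq, norm_center_sq]
    exact h

theorem eval_pderiv_limaconPoly (p : Plane) (i : Fin 2) :
    MvPolynomial.eval (fun j => p j) (MvPolynomial.pderiv i (limaconPoly a b r))
      = 2 * (‖p‖ ^ 2 - ⟪center a b, p⟫) * (2 * p i - center a b i) - 2 * r ^ 2 * p i := by
  have htwo : ∀ i : Fin 2, MvPolynomial.pderiv (R := ℝ) i 2 = 0 := fun i => by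
    rw [← map_ofNat MvPolynomial.C 2, MvPolynomial.pderiv_C]
  rw [norm_sq_plane, inner_center]
  fin_cases i <;>
    simp [limaconPoly, center, MvPolynomial.pderiv_X, Derivation.leibniz, Derivation.leibniz_pow,
      htwo] <;>
    ring

theorem isNonsingularAt_limaconPoly (hr : r ≠ 0) {p : Plane}
    (hp : p ∈ zeroSet (limaconPoly a b r)) (hp0 : p ≠ 0) :
    IsNonsingularAt (limaconPoly a b r) p := by
  by_contra h
  have hgrad : ∀ i, 2 * (‖p‖ ^ 2 - ⟪center a b, p⟫) * (2 * p i - center a b i)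
      - 2 * r ^ 2 * p i = 0 := fun i => by
    rw [← eval_pderiv_limaconPoly]
    exact not_not.mp (not_exists.mp h i)
  have hnorm : ‖p‖ ^ 2 ≠ 0 := pow_ne_zero 2 (norm_ne_zero_iff.mpr hp0)
  rw [mem_zeroSet_limaconPoly] at hp
  have heuler : (‖p‖ ^ 2 - ⟪center a b, p⟫) * ‖p‖ ^ 2 = 0 := by
    have hsum : p 0 * (2 * p 0 - center a b 0) + p 1 * (2 * p 1 - center a b 1)
        = 2 * ‖p‖ ^ 2 - ⟪center a b, p⟫ := by
      rw [norm_sq_plane, inner_plane]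
      ring
    linear_combination (p 0 * hgrad 0 + p 1 * hgrad 1) / 2 - hp
      - (‖p‖ ^ 2 - ⟪center a b, p⟫) * hsum - r ^ 2 * norm_sq_plane p
  rw [(mul_eq_zero_iff_right hnorm).mp heuler, zero_pow two_ne_zero] at hp
  exact mul_ne_zero (pow_ne_zero 2 hr) hnorm hp.symm

theorem IsNonsingularAt.of_mul_eq {F G Q : MvPolynomial (Fin 2) ℝ} {c : ℝ} (hc : c ≠ 0)
    (h : G * F = MvPolynomial.C c * Q) {p : Plane} (hp : p ∈ zeroSet F)
    (hQ : IsNonsingularAt Q p) : IsNonsingularAt F p := by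
  obtain ⟨i, hi⟩ := hQ
  have hderiv := congrArg
    (fun P => MvPolynomial.eval (fun j => p j) (MvPolynomial.pderiv i P)) h
  simp only [Derivation.leibniz, MvPolynomial.pderiv_C, map_add, smul_eq_mul, map_mul,
    MvPolynomial.eval_C, mem_zeroSet.mp hp, mul_zero, add_zero, zero_mul] at hderiv
  exact ⟨i, right_ne_zero_of_mul (hderiv.trans_ne (mul_ne_zero hc hi))⟩

end Singularity

section Conic

open Set
open scoped RealInnerProductSpace EuclideanSpace

variable {a b r : ℝ} {p u v : Plane}

theorem mem_invConic : p ∈ invConic a b r ↔ r ^ 2 * ‖p‖ ^ 2 = (1 - ⟪center a b, p⟫) ^ 2 := by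
  rw [invConic, mem_ofPred_eq, norm_sq_plane, inner_center]
  constructor <;> intro h <;> linear_combination h

theorem zero_notMem_invConic : (0 : Plane) ∉ invConic a b r := by
  simp [mem_invConic]

theorem inversion_mem_zeroSet_limaconPoly (hp : p ≠ 0) :
    EuclideanGeometry.inversion 0 1 p ∈ zeroSet (limaconPoly a b r) ↔ p ∈ invConic a b r := by
  have hnorm : ‖p‖ ≠ 0 := norm_ne_zero_iff.mpr hp
  have hinversion : EuclideanGeometry.inversion 0 1 p = (‖p‖ ^ 2)⁻¹ • p := by
    simp [EuclideanGeometry.inversion]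
  rw [hinversion, mem_zeroSet_limaconPoly, mem_invConic, norm_smul, real_inner_smul_right, norm_inv,
    norm_pow, norm_norm]
  field_simp
  exact eq_comm

theorem inversionImage_eq_invConic {S : Set Plane}
    (hS : S \ {0} = zeroSet (limaconPoly a b r) \ {0}) : inversionImage S = invConic a b r := by
  have hinvol := EuclideanGeometry.inversion_involutive (0 : Plane) one_ne_zero
  ext p
  rw [inversionImage, hS, image_eq_preimage_of_inverse hinvol hinvol, mem_preimage, mem_sdiff,
    mem_singleton_iff, EuclideanGeometry.inversion_eq_center one_ne_zero]
  refine ⟨fun ⟨h, hp⟩ => (inversion_mem_zeroSet_limaconPoly hp).mp h, fun h => ?_⟩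
  have hp : p ≠ 0 := ne_of_mem_of_not_mem h zero_notMem_invConic
  exact ⟨(inversion_mem_zeroSet_limaconPoly hp).mpr h, hp⟩

-- Such a line would meet the directrix in a point of the conic, that is, in its focus.
theorem not_subset_invConic_of_isLine (hr : r ≠ 0) {L : Set Plane} (hL : IsLine L) :
    ¬ L ⊆ invConic a b r := by
  obtain ⟨q, w, hw, rfl⟩ := hL
  intro hsub
  have hmem : ∀ t : ℝ, q + t • w ∈ invConic a b r := fun t => hsub (mem_range_self t)
  have hquad : ∀ t : ℝ, r ^ 2 * (‖q‖ ^ 2 + 2 * (t * ⟪q, w⟫) + t ^ 2 * ‖w‖ ^ 2)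
      = (1 - (⟪center a b, q⟫ + t * ⟪center a b, w⟫)) ^ 2 := by
    intro t
    have ht := mem_invConic.mp (hmem t)
    rwa [norm_add_sq_real, norm_smul, mul_pow, Real.norm_eq_abs, sq_abs, inner_add_right,
      real_inner_smul_right, real_inner_smul_right] at ht
  have hlead : r ^ 2 * ‖w‖ ^ 2 = ⟪center a b, w⟫ ^ 2 := by
    linear_combination (hquad 1 + hquad (-1)) / 2 - hquad 0
  have hcw : ⟪center a b, w⟫ ≠ 0 := fun h => by
    simp [h, hr, hw] at hlead
  obtain ⟨t, ht⟩ : ∃ t : ℝ, ⟪center a b, q + t • w⟫ = 1 := by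
    refine ⟨(1 - ⟪center a b, q⟫) / ⟪center a b, w⟫, ?_⟩
    rw [inner_add_right, real_inner_smul_right, div_mul_cancel₀ _ hcw, add_sub_cancel]
  have hfocus : q + t • w = 0 := by
    simpa [ht, hr] using mem_invConic.mp (hmem t)
  exact zero_notMem_invConic (hfocus ▸ hmem t)

theorem isIrreducibleQuadraticCurve_invConic (hr : r ≠ 0) :
    IsIrreducibleQuadraticCurve (invConic a b r) := by
  refine ⟨⟨r ^ 2 - a ^ 2, r ^ 2 - b ^ 2, -(a * b), a, b, -1, ?_, ?_, ?_⟩, ?_⟩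
  · by_contra! h
    refine pow_ne_zero 4 hr ?_
    linear_combination r ^ 2 * h.1 + a ^ 2 * h.2.1 - a * b * h.2.2
  · have hdet : Matrix.det !![r ^ 2 - a ^ 2, -(a * b), a; -(a * b), r ^ 2 - b ^ 2, b; a, b, -1]
        = -r ^ 4 := by
      simp only [Matrix.det_fin_three, Matrix.of_apply, Matrix.cons_val]
      ring
    rw [hdet, neg_ne_zero]
    exact pow_ne_zero 4 hr
  · ext p
    rw [invConic, mem_ofPred_eq, mem_ofPred_eq]
    constructor <;> intro h <;> linear_combination h
  · rintro ⟨L₁, L₂, hL₁, -, h⟩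
    exact not_subset_invConic_of_isLine hr hL₁ (h ▸ subset_union_left)

theorem mem_invConic_frame (huv : Orthonormal ℝ ![u, v]) {d : ℝ} (hc : center a b = d • v) :
    p ∈ invConic a b r ↔
      r ^ 2 * ⟪u, p⟫ ^ 2 + (r ^ 2 - d ^ 2) * ⟪v, p⟫ ^ 2 + 2 * d * ⟪v, p⟫ = 1 := by
  rw [mem_invConic, norm_sq_eq_of_orthonormal huv, hc, real_inner_smul_left]
  constructor <;> intro h <;> linear_combination h

theorem inner_sub_smul_frame (huv : Orthonormal ℝ ![u, v]) (k : ℝ) (p : Plane) :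
    ⟪u, p - k • v⟫ = ⟪u, p⟫ ∧ ⟪v, p - k • v⟫ = ⟪v, p⟫ - k := by
  obtain ⟨-, hv, huv⟩ := orthonormal_pair.mp huv
  simp [inner_sub_right, real_inner_smul_right, huv, hv]

theorem isParabola_invConic (hr : r ≠ 0) (h : a ^ 2 + b ^ 2 = r ^ 2) :
    IsParabola (invConic a b r) := by
  obtain ⟨u, v, huv, hc⟩ := exists_orthonormal_eq_norm_smul (center a b)
  have hd2 : ‖center a b‖ ^ 2 = r ^ 2 := (norm_center_sq a b).trans h
  have hd0 : ‖center a b‖ ≠ 0 := fun h0 => hr (by simpa [h0] using hd2.symm)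
  set d := ‖center a b‖
  refine ⟨(1 / (2 * d)) • v, u, v, -d / 2, huv, by simpa using hd0, ?_⟩
  ext p
  obtain ⟨hu, hv⟩ := inner_sub_smul_frame huv (1 / (2 * d)) p
  rw [mem_invConic_frame huv hc, mem_ofPred_eq, hu, hv, ← hd2]
  field_simp
  constructor <;> intro h <;> linear_combination h

theorem isEllipse_invConic (h : a ^ 2 + b ^ 2 < r ^ 2) : IsEllipse (invConic a b r) := by
  obtain ⟨u, v, huv, hc⟩ := exists_orthonormal_eq_norm_smul (center a b)
  have hk : 0 < r ^ 2 - ‖center a b‖ ^ 2 := sub_pos.mpr ((norm_center_sq a b).trans_lt h)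
  have hr : r ≠ 0 := sq_pos_iff.mp ((add_nonneg (sq_nonneg a) (sq_nonneg b)).trans_lt h)
  set d := ‖center a b‖
  refine ⟨(-d / (r ^ 2 - d ^ 2)) • v, u, v, 1 / √(r ^ 2 - d ^ 2), |r| / (r ^ 2 - d ^ 2), huv,
    by positivity, div_pos (abs_pos.mpr hr) hk, ?_⟩
  ext p
  obtain ⟨hu, hv⟩ := inner_sub_smul_frame huv (-d / (r ^ 2 - d ^ 2)) p
  rw [mem_invConic_frame huv hc, mem_ofPred_eq, hu, hv]
  simp only [div_pow, Real.sq_sqrt hk.le, sq_abs]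
  field_simp
  constructor <;> intro h
  · linear_combination (r ^ 2 - d ^ 2) * h
  · refine mul_left_cancel₀ hk.ne' ?_
    linear_combination h

theorem isHyperbola_invConic (hr : r ≠ 0) (h : r ^ 2 < a ^ 2 + b ^ 2) :
    IsHyperbola (invConic a b r) := by
  obtain ⟨u, v, huv, hc⟩ := exists_orthonormal_eq_norm_smul (center a b)
  have hk : 0 < ‖center a b‖ ^ 2 - r ^ 2 := sub_pos.mpr (h.trans_eq (norm_center_sq a b).symm)
  have hvu : Orthonormal ℝ ![v, u] := by
    obtain ⟨hu, hv, huv⟩ := orthonormal_pair.mp huv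
    exact orthonormal_pair.mpr ⟨hv, hu, inner_eq_zero_symm.mp huv⟩
  set d := ‖center a b‖
  refine ⟨(d / (d ^ 2 - r ^ 2)) • v, v, u, |r| / (d ^ 2 - r ^ 2), 1 / √(d ^ 2 - r ^ 2), hvu,
    div_pos (abs_pos.mpr hr) hk, by positivity, ?_⟩
  ext p
  obtain ⟨hu, hv⟩ := inner_sub_smul_frame huv (d / (d ^ 2 - r ^ 2)) p
  rw [mem_invConic_frame huv hc, mem_ofPred_eq, hu, hv]
  simp only [div_pow, Real.sq_sqrt hk.le, sq_abs]
  field_simp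
  constructor <;> intro h
  · linear_combination -(d ^ 2 - r ^ 2) * h
  · refine mul_left_cancel₀ hk.ne' ?_
    linear_combination -h

end Conic

section Curve

variable {α : Type*} {s t : Set α} {x : α}

theorem sdiff_singleton_eq_of_eq_or_eq_insert (h : s = t ∨ s = insert x t) :
    s \ {x} = t \ {x} := by
  rcases h with rfl | rfl
  · rfl
  · exact Set.insert_sdiff_of_mem _ rfl

theorem eq_of_sdiff_singleton_eq (hs : x ∈ s) (ht : x ∈ t) (h : s \ {x} = t \ {x}) : s = t := by
  rw [← Set.insert_sdiff_self_of_mem hs, h, Set.insert_sdiff_self_of_mem ht]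

theorem eq_zeroSet_of_eq_C_mul {S : Set Plane} {F Q : MvPolynomial (Fin 2) ℝ} {c : ℝ} {p : Plane}
    (hS : S = zeroSet F ∨ S = insert p (zeroSet F)) (hc : c ≠ 0) (h : F = MvPolynomial.C c * Q)
    (hp : p ∈ zeroSet Q) : S = zeroSet Q := by
  have hFQ : zeroSet F = zeroSet Q := by
    ext q
    rw [mem_zeroSet, mem_zeroSet, h, map_mul, MvPolynomial.eval_C, mul_eq_zero_iff_left hc]
  rwa [hFQ, Set.insert_eq_of_mem hp, or_self] at hS

theorem ne_zero_or_ne_zero_of_sq_le {a b r : ℝ} (hr : r ≠ 0) (h : r ^ 2 ≤ a ^ 2 + b ^ 2) :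
    a ≠ 0 ∨ b ≠ 0 := by
  by_contra! hab
  rw [hab.1, hab.2] at h
  linarith [sq_pos_of_ne_zero hr]

end Curve

end PlaneCurve

end

open PlaneCurve in
theorem theorem5p1_general
    (F : MvPolynomial (Fin 2) ℝ) (hF : Irreducible F)
    (𝒞 : Set Plane)
    (h𝒞 : 𝒞 = zeroSet F ∨ 𝒞 = insert 0 (zeroSet F))
    (a b r : ℝ) (hsub : primitive 𝒞 ⊆ circle a b r) (hnt : (primitive 𝒞).Nontrivial) :
    ((a ≠ 0 ∨ b ≠ 0 ∨ 0 ∈ 𝒞 → 𝒞 = zeroSet (limaconPoly a b r)) ∧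
      (a = 0 → b = 0 → 0 ∉ 𝒞 → 𝒞 = zeroSet (limaconPoly a b r) \ {0}) ∧
      (a ≠ 0 ∨ b ≠ 0 → ∃ c : ℝ, c ≠ 0 ∧ F = MvPolynomial.C c * limaconPoly a b r) ∧
      (a = 0 → b = 0 → ∃ c : ℝ, c ≠ 0 ∧
        (MvPolynomial.X 0 ^ 2 + MvPolynomial.X 1 ^ 2) * F
          = MvPolynomial.C c * limaconPoly a b r) ∧
      (r ^ 2 ≤ a ^ 2 + b ^ 2 → 𝒞 = Set.range (limacon a b r)) ∧
      (a ^ 2 + b ^ 2 < r ^ 2 → 𝒞 \ {0} = Set.range (limacon a b r)) ∧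
      IsIrreducibleQuadraticCurve (inversionImage 𝒞) ∧
      inversionImage 𝒞 = invConic a b r) ∧
    (a ^ 2 + b ^ 2 - r ^ 2 = 0 →
      IsParabola (inversionImage 𝒞) ∧ HasOrdinaryCuspAt 𝒞 0) ∧
    (a ^ 2 + b ^ 2 - r ^ 2 < 0 →
      IsEllipse (inversionImage 𝒞) ∧
      (a ≠ 0 ∨ b ≠ 0 ∨ 0 ∈ 𝒞 → IsIsolatedPointOf 𝒞 0) ∧
      (∀ p ∈ 𝒞, p ≠ 0 → IsNonsingularAt F p) ∧
      (∀ θ : ℝ, deriv (limacon a b r) θ ≠ 0)) ∧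
    (0 < a ^ 2 + b ^ 2 - r ^ 2 →
      IsHyperbola (inversionImage 𝒞) ∧
      HasNodeAt 𝒞 0 ∧
      (∀ p ∈ 𝒞, p ≠ 0 → IsNonsingularAt F p) ∧
      IsFrontOn (limacon a b r) Set.univ ∧
      (∀ θ : ℝ, deriv (limacon a b r) θ ≠ 0)) := by
  have hr : r ≠ 0 := ne_zero_of_nontrivial_circle (hnt.mono hsub)
  have hS : 𝒞 ⊆ insert 0 (zeroSet F) := h𝒞.elim (fun h => h ▸ Set.subset_insert _ _) Eq.subset
  have hdvd : F ∣ limaconPoly a b r := dvd_limaconPoly_of_primitive_subset hF hS hsub hnt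
  have hne : (zeroSet F \ {0}).Nonempty :=
    ((infinite_zeroSet_of_nonempty_primitive hS hnt.nonempty).sdiff
      (Set.finite_singleton 0)).nonempty
  obtain ⟨G, c, hc, hG, hGF⟩ := exists_mul_eq_C_mul_limaconPoly hF hr hdvd hne
  have hdiffF : 𝒞 \ {0} = zeroSet F \ {0} := sdiff_singleton_eq_of_eq_or_eq_insert h𝒞
  have hdiff : 𝒞 \ {0} = zeroSet (limaconPoly a b r) \ {0} :=
    hdiffF.trans (zeroSet_sdiff_zero_eq_of_mul_eq hc hG hGF)
  have hFQ (hab : a ≠ 0 ∨ b ≠ 0) : ∃ c : ℝ, c ≠ 0 ∧ F = MvPolynomial.C c * limaconPoly a b r :=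
    exists_eq_C_mul_of_dvd hF (irreducible_limaconPoly hr hab) hdvd
  have hset_of_ne (hab : a ≠ 0 ∨ b ≠ 0) : 𝒞 = zeroSet (limaconPoly a b r) :=
    let ⟨_, hc, hFc⟩ := hFQ hab
    eq_zeroSet_of_eq_C_mul h𝒞 hc hFc (zero_mem_zeroSet_limaconPoly a b r)
  have hset (h : a ≠ 0 ∨ b ≠ 0 ∨ 0 ∈ 𝒞) : 𝒞 = zeroSet (limaconPoly a b r) :=
    (or_assoc.mpr h).elim hset_of_ne fun h0 =>
      eq_of_sdiff_singleton_eq h0 (zero_mem_zeroSet_limaconPoly a b r) hdiff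
  have hset_of_le (h : r ^ 2 ≤ a ^ 2 + b ^ 2) : 𝒞 = zeroSet (limaconPoly a b r) :=
    hset_of_ne (ne_zero_or_ne_zero_of_sq_le hr h)
  have hinv : inversionImage 𝒞 = invConic a b r := inversionImage_eq_invConic hdiff
  have hns (p : Plane) (hp : p ∈ 𝒞) (hp0 : p ≠ 0) : IsNonsingularAt F p :=
    (isNonsingularAt_limaconPoly hr (hdiff.subset ⟨hp, hp0⟩).1 hp0).of_mul_eq hc hGF
      (hdiffF.subset ⟨hp, hp0⟩).1
  rw [hinv, sub_eq_zero, sub_neg, sub_pos]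
  refine ⟨⟨hset, fun _ _ h => ?_, hFQ, ?_, fun h => ?_, fun h => ?_,
    isIrreducibleQuadraticCurve_invConic hr, rfl⟩, fun h => ?_, fun h => ?_, fun h => ?_⟩
  · rw [← hdiff, Set.sdiff_singleton_eq_self h]
  · rintro rfl rfl
    exact exists_mul_eq_C_mul_limaconPoly_zero_zero hF hr hdvd hne
  · rw [hset_of_le h, zeroSet_limaconPoly_eq_range h]
  · rw [hdiff, zeroSet_limaconPoly_sdiff_zero_eq_range h]
  · exact ⟨isParabola_invConic hr h, hset_of_le h.ge ▸ hasOrdinaryCuspAt_limacon hr h⟩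
  · exact ⟨isEllipse_invConic h, fun h' => hset h' ▸ isIsolatedPointOf_limacon h, hns,
      deriv_limacon_ne_zero h.ne⟩
  · exact ⟨isHyperbola_invConic hr h, hset_of_le h.le ▸ hasNodeAt_limacon hr h, hns,
      isFrontOn_limacon h.ne', deriv_limacon_ne_zero h.ne'⟩

theorem theorem5p1
    (F : MvPolynomial (Fin 2) ℝ) (hF : Irreducible F)
    (𝒞 : Set PlaneCurve.Plane)
    (h𝒞 : 𝒞 = PlaneCurve.zeroSet F ∨ 𝒞 = insert 0 (PlaneCurve.zeroSet F))
    (a b r : ℝ) (hr : 0 < r)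
    (hPr : closure (PlaneCurve.primitive 𝒞) = PlaneCurve.circle a b r) :
    -- (1) the equation of the curve, as a set and as a polynomial
    ((a ≠ 0 ∨ b ≠ 0 ∨ 0 ∈ 𝒞 → 𝒞 = PlaneCurve.zeroSet (PlaneCurve.limaconPoly a b r)) ∧
      (a = 0 → b = 0 → 0 ∉ 𝒞 → 𝒞 = PlaneCurve.zeroSet (PlaneCurve.limaconPoly a b r) \ {0}) ∧
      (a ≠ 0 ∨ b ≠ 0 → ∃ c : ℝ, c ≠ 0 ∧
        F = MvPolynomial.C c * PlaneCurve.limaconPoly a b r) ∧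
      (a = 0 → b = 0 → ∃ c : ℝ, c ≠ 0 ∧
        (MvPolynomial.X 0 ^ 2 + MvPolynomial.X 1 ^ 2) * F
          = MvPolynomial.C c * PlaneCurve.limaconPoly a b r) ∧
      -- the curve is the limaçon
      (r ^ 2 ≤ a ^ 2 + b ^ 2 → 𝒞 = Set.range (PlaneCurve.limacon a b r)) ∧
      (a ^ 2 + b ^ 2 < r ^ 2 → 𝒞 \ {0} = Set.range (PlaneCurve.limacon a b r)) ∧
      -- its inversion
      PlaneCurve.IsIrreducibleQuadraticCurve (PlaneCurve.inversionImage 𝒞) ∧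
      PlaneCurve.inversionImage 𝒞 = PlaneCurve.invConic a b r) ∧
    -- (2)
    (a ^ 2 + b ^ 2 - r ^ 2 = 0 →
      PlaneCurve.IsParabola (PlaneCurve.inversionImage 𝒞) ∧
      PlaneCurve.HasOrdinaryCuspAt 𝒞 0) ∧
    -- (3)
    (a ^ 2 + b ^ 2 - r ^ 2 < 0 →
      PlaneCurve.IsEllipse (PlaneCurve.inversionImage 𝒞) ∧
      (a ≠ 0 ∨ b ≠ 0 ∨ 0 ∈ 𝒞 → PlaneCurve.IsIsolatedPointOf 𝒞 0) ∧
      (∀ p ∈ 𝒞, p ≠ 0 → PlaneCurve.IsNonsingularAt F p) ∧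
      (∀ θ : ℝ, deriv (PlaneCurve.limacon a b r) θ ≠ 0)) ∧
    -- (4)
    (0 < a ^ 2 + b ^ 2 - r ^ 2 →
      PlaneCurve.IsHyperbola (PlaneCurve.inversionImage 𝒞) ∧
      PlaneCurve.HasNodeAt 𝒞 0 ∧
      (∀ p ∈ 𝒞, p ≠ 0 → PlaneCurve.IsNonsingularAt F p) ∧
      PlaneCurve.IsFrontOn (PlaneCurve.limacon a b r) Set.univ ∧
      (∀ θ : ℝ, deriv (PlaneCurve.limacon a b r) θ ≠ 0)) := by
  exact theorem5p1_general F hF 𝒞 h𝒞 a b r (hPr ▸ subset_closure)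
    (PlaneCurve.nontrivial_of_closure_eq_circle hr.ne' hPr)
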